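/- **Theorem.** Let $l\ge 1$ and let $p_1,\dots,p_l$ be odd primes with $p_i=2p_{i+1}+1$ for $1\le i<l$ (a Cunningham chain). Put $n=p_1\cdots p_l$ and write $p_l-1=2^xs$ with $s$ odd. A Hopf–Galois structure on a separable field extension $L/K$ of degree $n$ is a $K$-Hopf algebra $H$ acting on $L$ so that $L$ is an $H$-module algebra and the map $L\otimes_K H\to\mathrm{End}_K(L)$, $y\otimes h\mapsto (z\mapsto y\,(h\cdot z))$, is bijective. Let $E$ be the Galois closure of $L/K$, $G=\mathrm{Gal}(E/K)$, $G'=\mathrm{Gal}(E/L)$. The structure is of cyclic type if $E\otimes_K H\cong E[C_n]$ as $E$-Hopf algebras, where $C_n$ is the cyclic group of order $n$. A permutation group of degree $n$ is realised by a Hopf–Galois structure of cyclic type if it is isomorphic, as a permutation group, to $G$ acting by left translation on $G/G'$ for some separable extension $L/K$ of degree $n$ admitting a Hopf–Galois structure of cyclic type. (Two permutation groups are isomorphic if there are an isomorphism of groups and a bijection of the underlying sets which intertwine the actions.) Then the number of isomorphism types of permutation groups of degree $n$ which are realised by a Hopf–Galois structure of cyclic type is $$\sum_{I\ni l}2^{\,l-2|I|}\left(\sum_{k=0}^{l-|I|}\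 \prod_{i=1}^{k}\frac{2^{\,l-|I|-(i-1)}-1}{2^i-1}\right)+\sum_{I\not\ni l}2^{\,l-1-2|I|}\,\Sigma_{l-|I|}\,\sigma_0(s).$$ Here $I$ runs over the subsets of $\{2,\dots,l\}$ containing no two consecutive integers (those containing $l$ in the first sum, those not containing $l$ in the second), $\sigma_0(s)$ is the number of positive divisors of $s$, empty products equal $1$, and $$\Sigma_m=\sum_{k=0}^{m-1}\bigl(2^{\,m-(k+1)}x+1\bigr)\prod_{i=1}^{k}\frac{2^{\,m-i}-1}{2^i-1}.$$ -/

import Mathlib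

open scoped TensorProduct

universe u

noncomputable section

/-- A Hopf–Galois structure on a field extension `L/K`: a `K`-Hopf algebra `H` acting `K`-linearly
on `L` such that `L` is an `H`-module algebra and the map `L ⊗[K] H → End_K(L)`,
`x ⊗ h ↦ (y ↦ x * (h • y))`, is bijective. -/
structure HopfGaloisStructure (K L : Type u) [Field K] [Field L] [Algebra K L] where
  /-- the Hopf algebra -/
  H : Type u
  [ring : Ring H]
  [hopf : HopfAlgebra K H]
  /-- its action on `L` -/
  act : H →ₐ[K] Module.End K L
  /-- `h • 1 = ε(h) 1` -/
  act_one : ∀ h : H, act h 1 = algebraMap K L (Coalgebra.counit (R := K) h)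
  /-- `h • (x * y) = ∑ (h₁ • x) * (h₂ • y)`, where `Δ h = ∑ h₁ ⊗ h₂` -/
  act_mul : ∀ (h : H) (x y : L),
    act h (x * y) = LinearMap.mul' K L
      (TensorProduct.map (act.toLinearMap.flip x) (act.toLinearMap.flip y)
        (Coalgebra.comul (R := K) h))
  bijective : Function.Bijective
    (TensorProduct.lift ((LinearMap.mul K (Module.End K L)).compl₁₂
      (Algebra.lmul K L).toLinearMap act.toLinearMap) : L ⊗[K] H →ₗ[K] Module.End K L)

attribute [instance] HopfGaloisStructure.ring HopfGaloisStructure.hopf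

/-- A Hopf–Galois structure on `L/K` with Hopf algebra `H` has type `N`, for `E` a Galois closure
of `L/K`, if `H` becomes the group algebra `E[N]` over `E`, i.e. `E ⊗[K] H` and `E[N]` are
isomorphic `E`-Hopf algebras (equivalently `H = E[N]^G` for a semilinear action of
`G = Gal(E/K)` on `E[N]`). -/
def HopfGaloisStructure.HasType {K L : Type u} [Field K] [Field L] [Algebra K L]
    (S : HopfGaloisStructure K L) (E : Type u) [Field E] [Algebra K E]
    (N : Type*) [Group N] : Prop :=
  Nonempty ((E ⊗[K] S.H) ≃ₐc[E] MonoidAlgebra E N)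

/-- Isomorphism of permutation groups: a group isomorphism together with a bijection of the
underlying sets intertwining the two actions. -/
def PermGroupIso (G X H Y : Type*) [Group G] [MulAction G X] [Group H] [MulAction H Y] : Prop :=
  ∃ (φ : G ≃* H) (e : X ≃ Y), ∀ (g : G) (x : X), e (g • x) = φ g • e x

/-- The permutation group `G` of degree `n` is realised by a Hopf–Galois structure of type `N`:
there are a separable extension `L/K` of degree `n` with Galois closure `E`, and a Hopf–Galois
structure on `L/K` of type `N`, such that `Gal(E/K)`, acting by left translation on
`Gal(E/K) / Gal(E/L)`, is isomorphic to `G` as a permutation group. -/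
def RealisedByHopfGalois (n : ℕ) (N : Type*) [Group N] (G : Subgroup (Equiv.Perm (Fin n))) :
    Prop :=
  ∃ (K E : Type u) (_ : Field K) (_ : Field E) (_ : Algebra K E) (L : IntermediateField K E),
    Algebra.IsSeparable K L ∧ IsNormalClosure K L E ∧ Module.finrank K L = n ∧
    PermGroupIso (E ≃ₐ[K] E) ((E ≃ₐ[K] E) ⧸ L.fixingSubgroup) G (Fin n) ∧
    ∃ S : HopfGaloisStructure K L, S.HasType E N

/-- Permutation groups of degree `n` up to isomorphism of permutation groups. -/
def permGroupSetoid (n : ℕ) : Setoid (Subgroup (Equiv.Perm (Fin n))) where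
  r G G' := PermGroupIso G (Fin n) G' (Fin n)
  iseqv :=
    { refl := fun _ => ⟨MulEquiv.refl _, Equiv.refl _, fun _ _ => rfl⟩
      symm := by
        rintro _ _ ⟨φ, e, h⟩
        refine ⟨φ.symm, e.symm, fun g x => ?_⟩
        rw [Equiv.symm_apply_eq, h, MulEquiv.apply_symm_apply, Equiv.apply_symm_apply]
      trans := by
        rintro _ _ _ ⟨φ, e, h⟩ ⟨ψ, f, k⟩
        refine ⟨φ.trans ψ, e.trans f, fun g x => ?_⟩
        simp only [Equiv.trans_apply, MulEquiv.trans_apply, h, k] }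

/-- The number of isomorphism types of permutation groups of degree `n` which are realised by a
Hopf–Galois structure of type `N` (on extensions of fields in `Type u`). -/
def numRealisedTypes (n : ℕ) (N : Type*) [Group N] : ℕ :=
  Set.ncard ((fun G => (⟦G⟧ : Quotient (permGroupSetoid n))) ''
    {G | RealisedByHopfGalois.{u} n N G})

/-- `(p 1, …, p l)` is a Cunningham chain of length `l`: odd primes with `p i = 2 p (i+1) + 1`. -/
structure IsCunninghamChain (l : ℕ) (p : ℕ → ℕ) : Prop where
  prime : ∀ i ∈ Finset.Icc 1 l, (p i).Prime
  odd : ∀ i ∈ Finset.Icc 1 l, Odd (p i)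
  step : ∀ i, 1 ≤ i → i < l → p i = 2 * p (i + 1) + 1

/-- The subsets of `{2, …, l}` containing no two consecutive integers. -/
def sparseSubsets (l : ℕ) : Finset (Finset ℕ) :=
  (Finset.Icc 2 l).powerset.filter fun I => ∀ i ∈ I, i + 1 ∉ I

/-- `Σ_m = ∑_{k=0}^{m-1} (2^{m-(k+1)} x + 1) ∏_{i=1}^k (2^{m-i} - 1) / (2^i - 1)`. -/
def SigmaSum (x m : ℕ) : ℚ :=
  ∑ k ∈ Finset.range m, ((2 : ℚ) ^ (m - (k + 1)) * x + 1) *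
    ∏ i ∈ Finset.Icc 1 k, ((2 : ℚ) ^ (m - i) - 1) / ((2 : ℚ) ^ i - 1)

end

/-! The realised permutation groups are exactly the transitive groups of affine maps of ℤ/n. In one
direction, the group-like elements of E ⊗ H ≅ E[N] form a copy of N that permutes the K-embeddings L
→ E simply transitively. The Galois group acts on the group-likes by automorphisms, hence on the
embeddings by affine maps (`exists_equiv_affine`). Conversely, a transitive affine group acts on
ℚ(ζ)(t), ζ a primitive n-th root of unity, by ζ ↦ ζ^u, t ↦ ζ^v t. Over the fixed field K, the powers
of t grade L = K(t) by ℤ/n; a grading is an action of the Hopf algebra of functions on ℤ/n, and this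
becomes E[C_n] over E (`RealisedByHopfGalois.of_isAffineVia`).

Write ℤ/n as the product of the fields F_{p_i}. A transitive affine group Γ is determined up to
isomorphism by the set I of coordinates whose translations it lacks and the group A of its linear
parts. On a coordinate i in I all linear parts are 1, and the translation part is a surjective
homomorphism A → ℤ/p_i. Among the p_j - 1 only p_{i-1} - 1 = 2 p_i is divisible by p_i, so this
homomorphism is unique up to a scalar, which a diagonal conjugation removes. Both I and A can be
read off the abstract group. The pairs that occur are those with A trivial on I and p_i dividing |A|
for i in I (`numRealisedTypes_eq_card`); this forces i ≥ 2 and i - 1 ∉ I.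

For fixed I, A is any subgroup of the product of F_{p_j}^× over j ∉ I with order divisible by these
p_i. It splits into a 2-part and an odd part. The odd part lies in a cyclic group, so it amounts to
a divisor; l - 2|I| coordinates remain free, and l, if free, contributes σ₀(s). The 2-part lies in
C_2^{l-|I|}, or in C_2^{l-|I|-1} × C_{2^x} if l ∉ I. Its subgroups are counted by separating those
that surject onto a cyclic factor (`sumSubgroups_prod`). -/

set_option linter.unusedSectionVars false

noncomputable section

/-! ### Group-like elements acting on embeddings -/

namespace HopfGaloisStructure

variable {K L E : Type u} [Field K] [Field L] [Field E] [Algebra K L] [Algebra K E]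
  (S : HopfGaloisStructure K L)

/-- The right action of `E ⊗[K] H` on `K`-linear maps `L → E`,
`f * (a ⊗ h) = (y ↦ a * f (h • y))`, for a fixed `f`. -/
def rightAct (f : L →ₗ[K] E) : E ⊗[K] S.H →ₗ[E] (L →ₗ[K] E) :=
  TensorProduct.AlgebraTensorModule.lift
    (LinearMap.toSpanSingleton E (S.H →ₗ[K] (L →ₗ[K] E))
      ((LinearMap.llcomp K L L E f) ∘ₗ S.act.toLinearMap))

@[simp]
lemma rightAct_tmul (f : L →ₗ[K] E) (a : E) (h : S.H) (y : L) :
    S.rightAct f (a ⊗ₜ h) y = a * f (S.act h y) := by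
  simp [rightAct]

lemma rightAct_add (f g : L →ₗ[K] E) (z : E ⊗[K] S.H) :
    S.rightAct (f + g) z = S.rightAct f z + S.rightAct g z := by
  induction z with
  | zero => simp
  | add z w hz hw => simp only [map_add, hz, hw]; abel
  | tmul a h => ext y; simp [mul_add]

lemma rightAct_zero (z : E ⊗[K] S.H) : S.rightAct 0 z = 0 := by
  have := S.rightAct_add 0 0 z
  simpa using this

lemma rightAct_mul (f : L →ₗ[K] E) (z w : E ⊗[K] S.H) :
    S.rightAct f (z * w) = S.rightAct (S.rightAct f z) w := by
  induction z with
  | zero => simp [rightAct_zero]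
  | add z z' hz hz' => simp only [add_mul, map_add, hz, hz', rightAct_add]
  | tmul a h =>
    induction w with
    | zero => simp
    | add w w' hw hw' => simp only [mul_add, map_add, hw, hw']
    | tmul b k =>
      ext y
      simp only [Algebra.TensorProduct.tmul_mul_tmul, rightAct_tmul, map_mul, Module.End.mul_apply]
      ring

/-- The semilinear action of `Gal(E/K)` on `E ⊗[K] H`. -/
def galAct (g : E ≃ₐ[K] E) : E ⊗[K] S.H →ₐ[K] E ⊗[K] S.H :=
  Algebra.TensorProduct.map g.toAlgHom (AlgHom.id K S.H)

lemma rightAct_galAct (g : E ≃ₐ[K] E) (f : L →ₗ[K] E) (z : E ⊗[K] S.H) :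
    S.rightAct (g.toLinearMap ∘ₗ f) (S.galAct g z) = g.toLinearMap ∘ₗ S.rightAct f z := by
  induction z with
  | zero => simp
  | add z w hz hw => simp only [map_add, hz, hw, LinearMap.comp_add]
  | tmul a h => ext y; simp [galAct]

lemma rightAct_apply_mul (f : L →ₐ[K] E) (z : E ⊗[K] S.H) (x y : L) :
    S.rightAct f.toLinearMap z (x * y) =
      LinearMap.mul' E E (TensorProduct.map
        ((LinearMap.applyₗ' E x).comp (S.rightAct f.toLinearMap))
        ((LinearMap.applyₗ' E y).comp (S.rightAct f.toLinearMap))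
        (Coalgebra.comul (R := E) z)) := by
  induction z with
  | zero => simp
  | add z w hz hw => simp only [map_add, LinearMap.add_apply, hz, hw]
  | tmul a h =>
    rw [rightAct_tmul, TensorProduct.comul_tmul, S.act_mul]
    generalize (Coalgebra.comul (R := K) h) = c
    induction c with
    | zero => simp
    | add c d hc hd => simp only [map_add, mul_add, hc, hd, TensorProduct.tmul_add]
    | tmul c d => simp [mul_left_comm]

lemma rightAct_apply_one (f : L →ₐ[K] E) (z : E ⊗[K] S.H) :
    S.rightAct f.toLinearMap z 1 = Coalgebra.counit (R := E) z := by
  induction z with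
  | zero => simp
  | add z w hz hw => simp only [map_add, LinearMap.add_apply, hz, hw]
  | tmul a h => simp [S.act_one, Algebra.smul_def, mul_comm]

/-- A group-like element of `E ⊗[K] H` sends `K`-embeddings `L → E` to `K`-embeddings. -/
def groupLikeAct (f : L →ₐ[K] E) {z : E ⊗[K] S.H} (hz : IsGroupLikeElem E z) : L →ₐ[K] E :=
  AlgHom.ofLinearMap (S.rightAct f.toLinearMap z)
    (by rw [rightAct_apply_one, hz.counit_eq_one])
    (fun x y => by rw [rightAct_apply_mul, hz.comul_eq_tmul_self]; simp)

/-- Bijectivity of L ⊗ H → End_K(L) puts every f ∘ T in the range, and these maps span Hom_K(L, E)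
over E. -/
lemma rightAct_surjective [FiniteDimensional K L] (f : L →ₐ[K] E) :
    Function.Surjective (S.rightAct f.toLinearMap) := by
  have key : ∀ T : Module.End K L, f.toLinearMap ∘ₗ T ∈ LinearMap.range (S.rightAct f.toLinearMap) := by
    intro T
    obtain ⟨w, rfl⟩ := S.bijective.2 T
    induction w with
    | zero => simp
    | add w w' hw hw' => rw [map_add, LinearMap.comp_add]; exact add_mem hw hw'
    | tmul a h => exact ⟨f a ⊗ₜ h, by ext y; simp⟩
  rw [← LinearMap.range_eq_top, eq_top_iff]
  rintro φ -
  let b := Module.finBasis K L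
  -- The endomorphism y ↦ b_i^*(y) · 1 is used for T; since f 1 = 1, the scalar φ(b_i) in E restores
  -- the value of φ on b_i.
  have : φ = ∑ i, φ (b i) • (f.toLinearMap ∘ₗ (LinearMap.toSpanSingleton K L 1 ∘ₗ b.coord i)) := by
    refine b.ext fun j => ?_
    simp [Finsupp.single_apply, LinearMap.sum_apply]
  rw [this]
  exact Submodule.sum_mem _ fun i _ => Submodule.smul_mem _ _ (key _)

lemma rightAct_bijective [FiniteDimensional K L] [Module.Finite E (E ⊗[K] S.H)]
    (hdim : Module.finrank E (E ⊗[K] S.H) = Module.finrank K L) (f : L →ₐ[K] E) :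
    Function.Bijective (S.rightAct f.toLinearMap) := by
  have hs := S.rightAct_surjective f
  exact ⟨(LinearMap.injective_iff_surjective_of_finrank_eq_finrank
    (by rw [hdim, Module.finrank_linearMap_self])).2 hs, hs⟩

/-- A Hopf–Galois structure of commutative type `N` makes `Gal(E/K)` act on the `K`-embeddings
`L → E` by affine transformations of `N`. -/
theorem exists_equiv_affine [FiniteDimensional K L] [Algebra.IsSeparable K L]
    (hsplit : ∀ x : L, ((minpoly K x).map (algebraMap K E)).Splits)
    {N : Type*} [CommGroup N] [Finite N] (hN : Nat.card N = Module.finrank K L)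
    (hS : S.HasType E N) :
    ∃ e : N ≃ (L →ₐ[K] E), ∀ g : E ≃ₐ[K] E, ∃ (τ : N) (α : N →* N), ∀ η,
      g.toAlgHom.comp (e η) = e (τ * α η) := by
  classical
  obtain ⟨θ⟩ := hS
  have := Fintype.ofFinite N
  let ψ : (E ⊗[K] S.H) ≃ₗ[E] (N →₀ E) :=
    (θ : (E ⊗[K] S.H) ≃ₐ[E] MonoidAlgebra E N).toLinearEquiv.trans (MonoidAlgebra.coeffLinearEquiv E)
  have hfin : Module.Finite E (E ⊗[K] S.H) := Module.Finite.equiv ψ.symm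
  have hdim : Module.finrank E (E ⊗[K] S.H) = Module.finrank K L := by
    rw [ψ.finrank_eq, Module.finrank_finsupp_self, ← hN, Nat.card_eq_fintype_card]
  let h : N →* E ⊗[K] S.H :=
    ((θ.symm : MonoidAlgebra E N ≃ₐ[E] (E ⊗[K] S.H)) : MonoidAlgebra E N →* (E ⊗[K] S.H)).comp
      (MonoidAlgebra.of E N)
  have hh : ∀ η, h η = θ.symm (MonoidAlgebra.single η 1) := fun η => rfl
  have hinj : Function.Injective h := by
    intro a b hab
    exact MonoidAlgebra.of_injective (θ.symm.injective hab)
  have hgl : ∀ η, IsGroupLikeElem E (h η) := fun η => by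
    rw [hh]
    exact (MonoidAlgebra.isGroupLikeElem_single_one η).map θ.symm
  have hcard : Nat.card (L →ₐ[K] E) = Module.finrank K L := AlgHom.natCard_of_splits K L E hsplit
  have hpos : 0 < Module.finrank K L := Module.finrank_pos
  have hfinX : Finite (L →ₐ[K] E) := Nat.finite_of_card_ne_zero (by omega)
  obtain ⟨f⟩ : Nonempty (L →ₐ[K] E) := (Nat.card_pos_iff.1 (by omega)).1
  have hbij := S.rightAct_bijective hdim f
  let e₀ : N → (L →ₐ[K] E) := fun η => S.groupLikeAct f (hgl η)
  have he₀ : ∀ η, (e₀ η).toLinearMap = S.rightAct f.toLinearMap (h η) := fun η => rfl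
  have hspan : ∀ z : E ⊗[K] S.H, z ∈ Submodule.span E (Set.range h) := by
    intro z
    rw [← (θ : (E ⊗[K] S.H) ≃ₐ[E] MonoidAlgebra E N).symm_apply_apply z]
    generalize (θ : (E ⊗[K] S.H) ≃ₐ[E] MonoidAlgebra E N) z = w
    change θ.symm w ∈ _
    induction w using MonoidAlgebra.induction_linear with
    | zero => rw [map_zero]; exact zero_mem _
    | add a b ha hb => rw [map_add]; exact add_mem ha hb
    | single η c =>
      have : θ.symm (MonoidAlgebra.single η c) = c • h η := by
        rw [hh, ← map_smul, MonoidAlgebra.smul_single, smul_eq_mul, mul_one]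
      rw [this]
      exact Submodule.smul_mem _ _ (Submodule.subset_span ⟨η, rfl⟩)
  -- An embedding σ is f acted on by some z, hence an E-combination of the embeddings `e₀ η`; by
  -- Dedekind's independence it must be one of them.
  have hsurj : Function.Surjective e₀ := by
    intro σ
    by_contra hσ
    refine (linearIndependent_algHom_toLinearMap K L E).notMem_span_image (s := Set.range e₀)
      (x := σ) hσ ?_
    obtain ⟨z, hz⟩ := hbij.2 σ.toLinearMap
    rw [← hz]
    have hz' := Submodule.mem_map_of_mem (f := S.rightAct f.toLinearMap) (hspan z)
    rw [Submodule.map_span, ← Set.range_comp] at hz'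
    rw [← Set.range_comp]
    exact hz'
  have hbij₀ : Function.Bijective e₀ := hsurj.bijective_of_nat_card_le (by omega)
  refine ⟨Equiv.ofBijective e₀ hbij₀, fun g => ?_⟩
  obtain ⟨τ, hτ⟩ := hsurj (g.toAlgHom.comp f)
  -- Since g ∘ (f * h η) = (f * h τ) * g(h η), injectivity of the action identifies h τ · g(h η)
  -- with a group-like h ν. So g permutes the image of N.
  have key : ∀ η, ∃ ν, S.galAct g (h η) = h ν ∧ g.toAlgHom.comp (e₀ η) = e₀ (τ * ν) := by
    intro η
    obtain ⟨ν, hν⟩ := hsurj (g.toAlgHom.comp (e₀ η))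
    have h1 : (g.toAlgHom.comp (e₀ η)).toLinearMap =
        S.rightAct f.toLinearMap (h τ * S.galAct g (h η)) := by
      have h2 := S.rightAct_galAct g f.toLinearMap (h η)
      have h3 : g.toLinearMap ∘ₗ f.toLinearMap = S.rightAct f.toLinearMap (h τ) := by
        rw [← he₀, hτ]; rfl
      rw [rightAct_mul, ← h3, h2, ← he₀]; rfl
    rw [← hν, he₀] at h1
    have h4 := hbij.1 h1
    refine ⟨τ⁻¹ * ν, ?_, by rw [mul_inv_cancel_left, hν]⟩
    rw [map_mul, h4, ← mul_assoc, ← map_mul, inv_mul_cancel, map_one, one_mul]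
  choose α hα hα' using key
  refine ⟨τ, { toFun := α, map_one' := hinj ?_, map_mul' := fun a b => hinj ?_ }, hα'⟩
  · rw [← hα, map_one, map_one]
  · rw [← hα, map_mul, map_mul, map_mul, hα, hα]

end HopfGaloisStructure

/-- The conjugate of a subgroup of `Perm (Fin n)` by a bijection `Fin n ≃ ZMod n` consists of
affine maps. -/
def IsAffineVia {n : ℕ} (G : Subgroup (Equiv.Perm (Fin n))) (e : Fin n ≃ ZMod n) : Prop :=
  ∀ g ∈ G, ∃ u v : ZMod n, ∀ x, e (g x) = u * e x + v

/-- Cosets of Gal(E/L) correspond to embeddings L → E by restriction, and an endomorphism of a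
cyclic group is multiplication by the image of the generator. -/
theorem RealisedByHopfGalois.exists_isAffineVia {n : ℕ} [NeZero n]
    {G : Subgroup (Equiv.Perm (Fin n))}
    (hG : RealisedByHopfGalois.{u} n (Multiplicative (ZMod n)) G) :
    MulAction.IsPretransitive G (Fin n) ∧ ∃ e : Fin n ≃ ZMod n, IsAffineVia G e := by
  obtain ⟨K, E, _, _, _, L, hsep, hnc, hdeg, ⟨φ, ε, hφ⟩, S, hS⟩ := hG
  have hfd : FiniteDimensional K L := Module.finite_of_finrank_pos (by rw [hdeg]; exact NeZero.pos n)
  have hnormal : Normal K E := IsNormalClosure.normal (K := L)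
  refine ⟨⟨fun x y => ?_⟩, ?_⟩
  · obtain ⟨g, hg⟩ := MulAction.exists_smul_eq (E ≃ₐ[K] E) (ε.symm x) (ε.symm y)
    refine ⟨φ g, ?_⟩
    rw [← ε.apply_symm_apply x, ← hφ, hg, ε.apply_symm_apply]
  obtain ⟨e, he⟩ := S.exists_equiv_affine (E := E) hnc.splits
    (N := Multiplicative (ZMod n)) (by simp [hdeg]) hS
  let r : (E ≃ₐ[K] E) ⧸ L.fixingSubgroup → (L →ₐ[K] E) :=
    Quotient.lift (fun g => g.toAlgHom.comp L.val) (by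
      intro a b hab
      ext x
      have := QuotientGroup.leftRel_apply.1 hab
      have h2 := (IntermediateField.mem_fixingSubgroup_iff L _).1 this x x.2
      have h3 : b x = a x := by
        have := congrArg a h2
        simpa using this
      exact h3.symm)
  have hr : ∀ g : E ≃ₐ[K] E, r (QuotientGroup.mk g) = g.toAlgHom.comp L.val := fun g => rfl
  have hrsmul : ∀ (g : E ≃ₐ[K] E) y, r (g • y) = g.toAlgHom.comp (r y) := by
    rintro g ⟨y⟩
    rfl
  have hrsurj : Function.Surjective r := by
    intro σ
    refine ⟨QuotientGroup.mk (AlgEquiv.ofBijective (AlgHom.liftNormal σ E)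
      (AlgHom.normal_bijective K E E _)), ?_⟩
    rw [hr]
    ext x
    exact AlgHom.liftNormal_commutes σ E x
  have hrinj : Function.Injective r := by
    rintro ⟨a⟩ ⟨b⟩ hab
    refine QuotientGroup.eq.2 ((IntermediateField.mem_fixingSubgroup_iff L _).2 fun x hx => ?_)
    have := DFunLike.congr_fun hab ⟨x, hx⟩
    have h3 : a x = b x := this
    have h4 : a⁻¹ (a x) = a⁻¹ (b x) := by rw [h3]
    simpa using h4.symm
  let ρ := Equiv.ofBijective r ⟨hrinj, hrsurj⟩
  refine ⟨((ε.symm.trans ρ).trans e.symm).trans Multiplicative.toAdd, fun g hg => ?_⟩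
  obtain ⟨γ, hγ⟩ := φ.surjective ⟨g, hg⟩
  obtain ⟨τ, α, hα⟩ := he γ
  refine ⟨(α (Multiplicative.ofAdd 1)).toAdd, τ.toAdd, fun x => ?_⟩
  have h1 : ε.symm (g x) = γ • ε.symm x := by
    rw [Equiv.symm_apply_eq, hφ, hγ, ε.apply_symm_apply]; rfl
  have h2 : ρ (γ • ε.symm x) = γ.toAlgHom.comp (ρ (ε.symm x)) := hrsmul _ _
  simp only [Equiv.trans_apply, h1, h2]
  obtain ⟨η, hη⟩ := e.surjective (ρ (ε.symm x))
  rw [← hη, hα, Equiv.symm_apply_apply, Equiv.symm_apply_apply, toAdd_mul, add_comm]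
  congr 1
  have h5 : η = (Multiplicative.ofAdd (1 : ZMod n)) ^ (η.toAdd.val) := by
    rw [← ofAdd_nsmul, nsmul_eq_mul, ZMod.natCast_zmod_val, mul_one, ofAdd_toAdd]
  conv_lhs => rw [h5, map_pow, toAdd_pow, nsmul_eq_mul, ZMod.natCast_zmod_val]
  rw [mul_comm]

/-! ### The Hopf algebra of functions on a finite abelian group -/

/-- The Hopf algebra of `K`-valued functions on a finite abelian group `A`, dual to `K[A]`. -/
def GroupFun (A : Type*) (K : Type*) : Type _ := A → K

namespace GroupFun

variable {A K : Type*} [AddCommGroup A] [Fintype A] [DecidableEq A] [Field K]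

instance : CommRing (GroupFun A K) := inferInstanceAs (CommRing (A → K))
instance : Algebra K (GroupFun A K) := inferInstanceAs (Algebra K (A → K))
instance : Module.Finite K (GroupFun A K) := inferInstanceAs (Module.Finite K (A → K))

/-- A function, as an element of the algebra of functions `A → K`. -/
def toPi : GroupFun A K ≃ₐ[K] (A → K) := AlgEquiv.refl

/-- Evaluation at a point. -/
def ev (a : A) : GroupFun A K →ₐ[K] K := (Pi.evalAlgHom K (fun _ : A => K) a).comp toPi.toAlgHom

omit [AddCommGroup A] [Fintype A] [DecidableEq A] in
lemma ev_toPi_symm (a : A) (f : A → K) : ev a (toPi.symm f) = f a := rfl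

omit [AddCommGroup A] [Fintype A] [DecidableEq A] in
lemma ext_ev {f g : GroupFun A K} (h : ∀ a, ev a f = ev a g) : f = g := funext h

/-- The indicator function of a point. -/
def δ (c : A) : GroupFun A K := toPi.symm (Pi.single c 1)

omit [AddCommGroup A] [Fintype A] in
lemma ev_δ (a c : A) : ev a (δ c : GroupFun A K) = if a = c then 1 else 0 := by
  simp [δ, ev_toPi_symm, Pi.single_apply]

omit [AddCommGroup A] [Fintype A] in
lemma δ_mul_δ (c d : A) : (δ c * δ d : GroupFun A K) = if c = d then δ c else 0 := by
  refine ext_ev fun a => ?_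
  rw [map_mul, apply_ite (ev a), map_zero]
  simp only [ev_δ]
  split_ifs <;> simp_all

omit [AddCommGroup A] in
lemma sum_δ : (∑ c : A, δ c : GroupFun A K) = 1 := by
  refine ext_ev fun a => ?_
  rw [map_sum, map_one]
  simp [ev_δ]

/-- The basis of indicator functions. -/
def basis : Module.Basis A K (GroupFun A K) := (Pi.basisFun K A).map toPi.toLinearEquiv.symm

omit [AddCommGroup A] in
@[simp]
lemma basis_apply (c : A) : (basis c : GroupFun A K) = δ c := by
  simp [basis, δ]

/-- Translation of functions, as a map to functions with values in functions. -/
def translate : GroupFun A K →ₐ[K] (A → GroupFun A K) where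
  toFun f := fun b => toPi.symm fun a => ev (a + b) f
  map_one' := rfl
  map_mul' _ _ := rfl
  map_zero' := rfl
  map_add' _ _ := rfl
  commutes' _ := rfl

/-- The tensor product of two function algebras as an algebra of functions with values in
functions. -/
def tensorEquiv (B : Type*) [CommRing B] [Algebra K B] :
    B ⊗[K] GroupFun A K ≃ₐ[B] (A → B) :=
  (Algebra.TensorProduct.congr AlgEquiv.refl toPi).trans
    (Algebra.TensorProduct.piScalarRight K B B A)

omit [AddCommGroup A] in
lemma tensorEquiv_tmul {B : Type*} [CommRing B] [Algebra K B] (x : B) (f : GroupFun A K) (a : A) :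
    tensorEquiv B (x ⊗ₜ[K] f) a = ev a f • x := by
  rw [tensorEquiv, AlgEquiv.trans_apply, Algebra.TensorProduct.congr_apply,
    Algebra.TensorProduct.map_tmul, Algebra.TensorProduct.piScalarRight_tmul_apply]
  rfl

/-- The comultiplication `Δ f = ((a, b) ↦ f (a + b))`. -/
def comulHom : GroupFun A K →ₐ[K] GroupFun A K ⊗[K] GroupFun A K :=
  (((tensorEquiv (A := A) (K := K) (GroupFun A K)).symm.toAlgHom).restrictScalars K).comp translate

lemma comulHom_δ (c : A) :
    comulHom (δ c : GroupFun A K) = ∑ b : A, δ (c - b) ⊗ₜ[K] δ b := by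
  refine (AlgEquiv.symm_apply_eq (tensorEquiv (GroupFun A K))).2 ?_
  rw [map_sum]
  refine funext fun j => ext_ev (A := A) (K := K) fun a => ?_
  simp only [Finset.sum_apply, tensorEquiv_tmul, ev_δ, map_sum, map_smul, smul_eq_mul, ite_mul,
    one_mul, zero_mul, Finset.sum_ite_eq, Finset.mem_univ, if_true]
  refine (ev_δ (a + j) c).trans ?_
  simp only [eq_sub_iff_add_eq]

/-- The counit `f ↦ f 0`. -/
def counitHom : GroupFun A K →ₐ[K] K := ev 0

omit [Fintype A] in
lemma counitHom_δ (c : A) : counitHom (δ c : GroupFun A K) = if c = 0 then 1 else 0 := by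
  rw [counitHom, ev_δ]
  simp only [eq_comm]

omit [AddCommGroup A] in
lemma algHom_ext {B : Type*} [Semiring B] [Algebra K B] {φ ψ : GroupFun A K →ₐ[K] B}
    (h : ∀ c, φ (δ c) = ψ (δ c)) : φ = ψ :=
  AlgHom.toLinearMap_injective (basis.ext fun c => by simpa using h c)

instance : Bialgebra K (GroupFun A K) :=
  Bialgebra.ofAlgHom comulHom counitHom
    (algHom_ext fun c => by
      simp only [AlgHom.comp_apply, comulHom_δ, map_sum, Algebra.TensorProduct.map_tmul,
        AlgHom.id_apply, TensorProduct.sum_tmul, TensorProduct.tmul_sum]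
      simp only [AlgEquiv.coe_toAlgHom, Algebra.TensorProduct.assoc_tmul]
      have : ∀ b : A, (∑ x : A, (δ (c - b - x) : GroupFun A K) ⊗ₜ[K]
          ((δ x : GroupFun A K) ⊗ₜ[K] (δ b : GroupFun A K))) =
          ∑ x : A, δ (c - x) ⊗ₜ[K] (δ (x - b) ⊗ₜ[K] δ b) := by
        intro b
        refine Fintype.sum_equiv (Equiv.addRight b) _ _ fun x => ?_
        simp [sub_sub, add_comm]
      rw [Finset.sum_congr rfl fun b _ => this b, Finset.sum_comm])
    (algHom_ext fun c => by
      simp [comulHom_δ, counitHom_δ, sub_eq_zero, TensorProduct.ite_tmul])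
    (algHom_ext fun c => by
      simp [comulHom_δ, counitHom_δ, TensorProduct.tmul_ite])

lemma comul_δ (c : A) : Coalgebra.comul (R := K) (δ c : GroupFun A K) =
    ∑ b : A, δ (c - b) ⊗ₜ[K] δ b := comulHom_δ c

lemma counit_δ (c : A) : Coalgebra.counit (R := K) (δ c : GroupFun A K) = if c = 0 then 1 else 0 :=
  counitHom_δ c

/-- The antipode `f ↦ (a ↦ f (-a))`. -/
def antipodeHom : GroupFun A K →ₐ[K] GroupFun A K where
  toFun f := toPi.symm fun a => ev (-a) f
  map_one' := rfl
  map_mul' _ _ := rfl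
  map_zero' := rfl
  map_add' _ _ := rfl
  commutes' _ := rfl

omit [Fintype A] in
lemma antipodeHom_δ (c : A) : antipodeHom (δ c : GroupFun A K) = δ (-c) := by
  refine ext_ev fun a => (ev_δ (-a) c).trans ?_
  simp only [ev_δ, neg_eq_iff_eq_neg]

instance : HopfAlgebra K (GroupFun A K) where
  antipode := antipodeHom.toLinearMap
  mul_antipode_rTensor_comul := by
    refine basis.ext fun c => ?_
    simp only [basis_apply, LinearMap.comp_apply, comul_δ, map_sum, LinearMap.rTensor_tmul,
      AlgHom.toLinearMap_apply, antipodeHom_δ, LinearMap.mul'_apply, δ_mul_δ, counit_δ,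
      neg_sub, sub_eq_iff_eq_add, left_eq_add]
    by_cases hc : c = 0
    · simp [hc, sum_δ]
    · simp [hc]
  mul_antipode_lTensor_comul := by
    refine basis.ext fun c => ?_
    simp only [basis_apply, LinearMap.comp_apply, comul_δ, map_sum, LinearMap.lTensor_tmul,
      AlgHom.toLinearMap_apply, antipodeHom_δ, LinearMap.mul'_apply, δ_mul_δ, counit_δ,
      sub_eq_iff_eq_add, neg_add_cancel]
    by_cases hc : c = 0
    · subst hc
      simp only [zero_sub, if_true, Algebra.linearMap_apply, map_one]
      rw [← sum_δ]
      exact Fintype.sum_equiv (Equiv.neg A) _ _ fun x => rfl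
    · simp [hc]

end GroupFun

/-! ### Gradings as Hopf–Galois structures, and splitting by characters -/

namespace GroupFun

section Graded

variable {A : Type} [AddCommGroup A] [Fintype A] [DecidableEq A]
  {K L : Type u} [Field K] [Field L] [Algebra K L] (b : Module.Basis A K L)

/-- Functions on `A` act diagonally on a module with a basis indexed by `A`. -/
def diagAct : GroupFun A K →ₐ[K] Module.End K L where
  toFun f := b.constr K fun i => ev i f • b i
  map_one' := b.ext fun i => by simp
  map_mul' f g := b.ext fun i => by
    simp only [Module.Basis.constr_basis, map_mul, Module.End.mul_apply, map_smul]
    rw [mul_smul, smul_comm]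
  map_zero' := b.ext fun i => by simp
  map_add' f g := b.ext fun i => by
    simp only [Module.Basis.constr_basis, map_add, LinearMap.add_apply, add_smul]
  commutes' r := b.ext fun i => by simp [Algebra.algebraMap_eq_smul_one]

lemma diagAct_basis (f : GroupFun A K) (i : A) : diagAct b f (b i) = ev i f • b i :=
  b.constr_basis K _ i

/-- `δ c` acts as the projection to degree c, and the degree c part of a product collects the
products of parts of degrees c - a and a. -/
lemma diagAct_δ_mul (hb : ∀ i j, ∃ c : K, b i * b j = c • b (i + j)) (c : A) (x y : L) :
    diagAct b (δ c) (x * y) = ∑ a : A, diagAct b (δ (c - a)) x * diagAct b (δ a) y := by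
  have : (LinearMap.mul K L).compr₂ (diagAct b (δ c)) =
      ∑ a : A, (LinearMap.mul K L).compl₁₂ (diagAct b (δ (c - a))) (diagAct b (δ a)) := by
    refine LinearMap.ext_basis b b fun i j => ?_
    obtain ⟨r, hr⟩ := hb i j
    simp only [LinearMap.compr₂_apply, LinearMap.mul_apply', LinearMap.sum_apply,
      LinearMap.compl₁₂_apply, diagAct_basis, ev_δ, hr, map_smul, ite_smul, one_smul, zero_smul,
      mul_ite, mul_zero, Finset.sum_ite_eq, Finset.mem_univ, if_true, ite_mul, zero_mul,
      eq_sub_iff_add_eq, smul_ite, smul_zero]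
  simpa [LinearMap.sum_apply] using LinearMap.congr_fun₂ this x y

/-- The Hopf–Galois structure given by a grading of `L` by `A` with one-dimensional components. -/
def gradedHopfGalois (h0 : b 0 = 1) (hb : ∀ i j, ∃ c : K, b i * b j = c • b (i + j)) :
    HopfGaloisStructure K L where
  H := GroupFun A K
  act := diagAct b
  act_one f := by
    rw [← h0, diagAct_basis, h0, Algebra.smul_def, mul_one]
    rfl
  act_mul f x y := by
    have : LinearMap.applyₗ (x * y) ∘ₗ (diagAct b).toLinearMap =
        LinearMap.mul' K L ∘ₗ TensorProduct.map ((diagAct b).toLinearMap.flip x)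
          ((diagAct b).toLinearMap.flip y) ∘ₗ Coalgebra.comul (R := K) := by
      refine basis.ext fun c => ?_
      simp [comul_δ, diagAct_δ_mul b hb]
    exact LinearMap.congr_fun this f
  bijective := by
    have := Module.Finite.of_basis b
    have hs : Function.Surjective (TensorProduct.lift ((LinearMap.mul K (Module.End K L)).compl₁₂
        (Algebra.lmul K L).toLinearMap (diagAct b).toLinearMap) :
          L ⊗[K] GroupFun A K →ₗ[K] Module.End K L) := by
      intro T
      -- `δ i` isolates the i-th basis component, and multiplication by T(b_i) / b_i then sends b_i
      -- to T(b_i).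
      refine ⟨∑ i, (T (b i) * (b i)⁻¹) ⊗ₜ δ i, b.ext fun j => ?_⟩
      simp [diagAct_basis, ev_δ, LinearMap.sum_apply, b.ne_zero]
    refine ⟨(LinearMap.injective_iff_surjective_of_finrank_eq_finrank ?_).2 hs, hs⟩
    change _ = Module.finrank K (L →ₗ[K] L)
    rw [Module.finrank_tensorProduct, Module.finrank_linearMap,
      Module.finrank_eq_card_basis b,
      Module.finrank_eq_card_basis (basis (A := A) (K := K))]

end Graded

section Fourier
variable {A : Type} [AddCommGroup A] [Fintype A] [DecidableEq A] {K E : Type u} [Field K] [Field E]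
  [Algebra K E]

/-- The element of `E ⊗ K^A` which corresponds to an additive character of `A`. -/
def charElem : AddChar A E →* E ⊗[K] GroupFun A K where
  toFun χ := (tensorEquiv E).symm (fun a => χ a)
  map_one' := map_one (tensorEquiv (A := A) (K := K) E).symm
  map_mul' χ χ' := map_mul (tensorEquiv (A := A) (K := K) E).symm (fun a => χ a) (fun a => χ' a)

lemma charElem_apply (χ : AddChar A E) :
    charElem (K := K) χ = ∑ a : A, χ a ⊗ₜ[K] δ a := by
  refine (AlgEquiv.symm_apply_eq (tensorEquiv E)).2 ?_
  refine funext fun a => ?_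
  simp [Finset.sum_apply, tensorEquiv_tmul, ev_δ]

lemma isGroupLikeElem_charElem (χ : AddChar A E) : IsGroupLikeElem E (charElem (K := K) χ) where
  counit_eq_one := by
    simp [charElem_apply, counit_δ]
  comul_eq_tmul_self := by
    simp only [charElem_apply, map_sum, TensorProduct.comul_tmul, comul_δ, TensorProduct.tmul_sum,
      TensorProduct.sum_tmul, CommSemiring.comul_apply,
      TensorProduct.AlgebraTensorModule.tensorTensorTensorComm_tmul]
    rw [Finset.sum_comm]
    refine Finset.sum_congr rfl fun b _ => ?_
    refine Fintype.sum_equiv (Equiv.subRight b) _ _ fun x => ?_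
    rw [Equiv.subRight_apply]
    -- Multiplicativity χ(x) = χ(x - b) χ(b) separates the two tensor factors after the change of
    -- variable x ↦ x - b.
    have h1 : χ x ⊗ₜ[K] (δ b : GroupFun A K) = χ (x - b) • (χ b ⊗ₜ[K] (δ b : GroupFun A K)) := by
      rw [TensorProduct.smul_tmul', smul_eq_mul, ← AddChar.map_add_eq_mul, sub_add_cancel]
    rw [h1, ← TensorProduct.smul_tmul, TensorProduct.smul_tmul', smul_eq_mul, mul_one]

/-- The characters of `A` form a basis of the functions on `A` if there are enough of them. -/
lemma exists_bialgEquiv {N : Type} [CommGroup N] [Finite N] (χ : N →* AddChar A E)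
    (hχ : Function.Injective χ) (hcard : Nat.card N = Nat.card A) :
    Nonempty ((E ⊗[K] GroupFun A K) ≃ₐc[E] MonoidAlgebra E N) := by
  have := Fintype.ofFinite N
  let F : MonoidAlgebra E N →ₐ[E] E ⊗[K] GroupFun A K :=
    MonoidAlgebra.lift E _ N (charElem.comp χ)
  have hF : ∀ η, F (MonoidAlgebra.single η 1) = charElem (χ η) := fun η => by
    simp [F, MonoidAlgebra.lift_single]
  let F' : MonoidAlgebra E N →ₐc[E] E ⊗[K] GroupFun A K := BialgHom.ofAlgHom F
    (MonoidAlgebra.algHom_ext (fun η => by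
      simp [hF, (isGroupLikeElem_charElem (K := K) (χ η)).counit_eq_one]) (by ext))
    (MonoidAlgebra.algHom_ext (fun η => by
      simp [hF, (isGroupLikeElem_charElem (K := K) (χ η)).comul_eq_tmul_self]) (by ext))
  let ψ : (N →₀ E) →ₗ[E] (A → E) := (tensorEquiv (A := A) (K := K) E).toLinearMap ∘ₗ F.toLinearMap ∘ₗ
    (MonoidAlgebra.coeffLinearEquiv E).symm.toLinearMap
  have hψχ : ψ = Finsupp.linearCombination E (fun η a => χ η a) := by
    refine Finsupp.lhom_ext' fun η => LinearMap.ext_ring ?_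
    have h1 : (MonoidAlgebra.coeffLinearEquiv E).symm (Finsupp.single η (1 : E)) =
      (MonoidAlgebra.single η 1 : MonoidAlgebra E N) := rfl
    simp only [ψ, LinearMap.comp_apply, Finsupp.lsingle_apply, LinearEquiv.coe_coe, h1,
      AlgHom.toLinearMap_apply, hF, Finsupp.linearCombination_single, one_smul]
    exact (tensorEquiv (A := A) (K := K) E).apply_symm_apply _
  have hψ : Function.Injective ψ := by
    rw [hψχ]
    refine (linearIndependent_monoidHom (Multiplicative A) E).comp
      (fun η => (χ η).toMonoidHom) fun η η' h => hχ ?_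
    ext a
    exact DFunLike.congr_fun h (Multiplicative.ofAdd a)
  have hψ' : Function.Bijective ψ := by
    refine ⟨hψ, (LinearMap.injective_iff_surjective_of_finrank_eq_finrank ?_).1 hψ⟩
    rw [Module.finrank_finsupp_self, Module.finrank_fintype_fun_eq_card,
      ← Nat.card_eq_fintype_card, ← Nat.card_eq_fintype_card, hcard]
  have hbij : Function.Bijective F' := by
    have : (F' : MonoidAlgebra E N → _) =
        (tensorEquiv (A := A) (K := K) E).symm ∘ ψ ∘ (MonoidAlgebra.coeffLinearEquiv E) := by
      funext z
      exact ((tensorEquiv (A := A) (K := K) E).symm_apply_apply _).symm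
    rw [this]
    exact (AlgEquiv.bijective _).comp (hψ'.comp (LinearEquiv.bijective _))
  exact ⟨(BialgEquiv.ofBijective F' hbij).symm⟩

end Fourier

end GroupFun

/-! ### Realising transitive affine groups by field extensions -/

/-- A field with `n`-th roots of unity and a variable `t`, so that each `(u, v)` gives an
automorphism which raises roots of unity to the power `u` and multiplies `t` by a root of unity. -/
lemma exists_field_with_affine_automorphisms_aux (n : ℕ) [NeZero n] (F : Type) [Field F]
    [Algebra ℚ F] [IsCyclotomicExtension {n} ℚ F] :
    ∃ (E : Type u) (_ : Field E) (ψ : AddChar (ZMod n) E) (t : E), ψ.IsPrimitive ∧ t ≠ 0 ∧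
      (∀ (u : (ZMod n)ˣ) (v : ZMod n), ∃ φ : E ≃+* E, (∀ a, φ (ψ a) = ψ (u * a)) ∧
        φ t = ψ v * t) ∧
      ∀ φ φ' : E ≃+* E, (∀ a, φ (ψ a) = φ' (ψ a)) → φ t = φ' t → φ = φ' := by
  classical
  let E₀ := FractionRing (Polynomial F)
  let E := ULift.{u} E₀
  let ζ : F := IsCyclotomicExtension.zeta n ℚ F
  have hζ : IsPrimitiveRoot ζ n := IsCyclotomicExtension.zeta_spec n ℚ F
  let ι : F →+* E := (ULift.ringEquiv.symm : E₀ ≃+* E).toRingHom.comp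
    ((algebraMap (Polynomial F) E₀).comp Polynomial.C)
  have hζ' : IsPrimitiveRoot (ι ζ) n := hζ.map_of_injective ι.injective
  let ψ₀ : AddChar (ZMod n) F := AddChar.zmodChar n hζ.pow_eq_one
  let ψ : AddChar (ZMod n) E := AddChar.zmodChar n hζ'.pow_eq_one
  have hψ : ∀ a, ψ a = ι (ψ₀ a) := fun a => by
    simp only [ψ, ψ₀, AddChar.zmodChar_apply, map_pow]
  let t : E := ULift.ringEquiv.symm (algebraMap (Polynomial F) E₀ Polynomial.X)
  have ht : t ≠ 0 := by
    intro h
    rw [EmbeddingLike.map_eq_zero_iff, FaithfulSMul.algebraMap_eq_zero_iff] at h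
    exact Polynomial.X_ne_zero h
  refine ⟨E, inferInstance, ψ, t, AddChar.zmodChar_primitive_of_primitive_root n hζ', ht, ?_, ?_⟩
  · intro u v
    -- Irreducibility of the cyclotomic polynomial over ℚ provides an automorphism for every unit u.
    let σ : F ≃ₐ[ℚ] F := (IsCyclotomicExtension.autEquivPow F
      (Polynomial.cyclotomic.irreducible_rat (NeZero.pos n))).symm u
    have hσ : ∀ a, σ (ψ₀ a) = ψ₀ (u * a) := by
      intro a
      have h1 : σ ζ = ζ ^ (u : ZMod n).val := by
        rw [← hζ.autToPow_spec ℚ σ]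
        congr 2
        exact congrArg Units.val (MulEquiv.apply_symm_apply (IsCyclotomicExtension.autEquivPow F
          (Polynomial.cyclotomic.irreducible_rat (NeZero.pos n))) u)
      have h2 : ψ₀ (u * a) = ψ₀ (u : ZMod n) ^ a.val := by
        rw [← AddChar.map_nsmul_eq_pow, nsmul_eq_mul, ZMod.natCast_zmod_val, mul_comm]
      rw [h2]
      simp only [ψ₀, AddChar.zmodChar_apply, map_pow, h1]
    have hinv : Invertible (ψ₀ v) := invertibleOfNonzero (by
      simp only [ψ₀, AddChar.zmodChar_apply]; exact pow_ne_zero _ (hζ.ne_zero (NeZero.ne n)))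
    -- σ acts on the coefficients, then X is scaled by the root of unity; the result extends to the
    -- fraction field.
    let p : Polynomial F ≃+* Polynomial F := (Polynomial.mapEquiv σ.toRingEquiv).trans
      (Polynomial.algEquivCMulXAddC (ψ₀ v) 0).toRingEquiv
    let q : E₀ ≃+* E₀ := IsFractionRing.ringEquivOfRingEquiv p
    have hq : ∀ f, q (algebraMap _ _ f) = algebraMap _ _ (p f) := fun f =>
      IsFractionRing.ringEquivOfRingEquiv_algebraMap p f
    refine ⟨(ULift.ringEquiv.trans q).trans ULift.ringEquiv.symm, fun a => ?_, ?_⟩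
    · rw [hψ, hψ]
      simp [ι, hq, p, hσ]
    · rw [hψ]
      simp [ι, t, hq, p]
  · intro φ φ' h1 h2
    have h3 : (φ : E →+* E).comp ι = (φ' : E →+* E).comp ι := by
      have h4 : ((φ : E →+* E).comp ι).toRatAlgHom = ((φ' : E →+* E).comp ι).toRatAlgHom := by
        refine (hζ.powerBasis ℚ).algHom_ext ?_
        have h5 : ψ 1 = ι ζ := by
          rw [hψ]
          congr 1
          have := AddChar.zmodChar_apply' hζ.pow_eq_one 1
          simpa using this
        have := h1 1
        rw [h5] at this
        simpa using this
      exact RingHom.ext fun x => DFunLike.congr_fun h4 x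
    have h6 : ((φ : E →+* E).comp (ULift.ringEquiv.symm : E₀ ≃+* E).toRingHom) =
        ((φ' : E →+* E).comp (ULift.ringEquiv.symm : E₀ ≃+* E).toRingHom) := by
      refine IsLocalization.ringHom_ext (nonZeroDivisors (Polynomial F)) ?_
      refine Polynomial.ringHom_ext (fun a => DFunLike.congr_fun h3 a) h2
    exact RingEquiv.ext fun x => DFunLike.congr_fun h6 (ULift.ringEquiv x)

lemma exists_field_with_affine_automorphisms (n : ℕ) [NeZero n] :
    ∃ (E : Type u) (_ : Field E) (ψ : AddChar (ZMod n) E) (t : E), ψ.IsPrimitive ∧ t ≠ 0 ∧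
      (∀ (u : (ZMod n)ˣ) (v : ZMod n), ∃ φ : E ≃+* E, (∀ a, φ (ψ a) = ψ (u * a)) ∧
        φ t = ψ v * t) ∧
      ∀ φ φ' : E ≃+* E, (∀ a, φ (ψ a) = φ' (ψ a)) → φ t = φ' t → φ = φ' := by
  have : NeZero (n : ℚ) := ⟨Nat.cast_ne_zero.2 (NeZero.ne n)⟩
  exact @exists_field_with_affine_automorphisms_aux n _ (CyclotomicField n ℚ) _
    (CyclotomicField.algebra n ℚ) (CyclotomicField.isCyclotomicExtension n ℚ)

/-- `L = K(t)` with `t ^ n ∈ K`, of degree `n`, has a Hopf–Galois structure of cyclic type if the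
`n`-th roots of unity are in `E`. -/
lemma exists_hopfGaloisStructure_of_pow_mem {K L E : Type u} [Field K] [Field L] [Field E]
    [Algebra K L] [Algebra K E] {n : ℕ} [NeZero n] (ψ : AddChar (ZMod n) E) (hψ : ψ.IsPrimitive)
    (t : L) (a : K) (ht : t ^ n = algebraMap K L a) (hdeg : (minpoly K t).natDegree = n)
    (hfin : Module.finrank K L = n) :
    ∃ S : HopfGaloisStructure K L, S.HasType E (Multiplicative (ZMod n)) := by
  classical
  have hli : LinearIndependent K (fun i : ZMod n => t ^ i.val) :=
    (linearIndependent_pow t).comp (fun i : ZMod n => (⟨i.val, by rw [hdeg]; exact i.val_lt⟩ :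
      Fin (minpoly K t).natDegree)) fun i j h => ZMod.val_injective n (congrArg Fin.val h)
  let b : Module.Basis (ZMod n) K L :=
    basisOfLinearIndependentOfCardEqFinrank hli (by rw [ZMod.card, hfin])
  have hb : ∀ i, b i = t ^ i.val := fun i => by simp [b]
  refine ⟨GroupFun.gradedHopfGalois b (by simp [hb]) fun i j => ?_, ?_⟩
  · refine ⟨a ^ ((i.val + j.val) / n), ?_⟩
    rw [hb, hb, hb, ZMod.val_add, Algebra.smul_def, map_pow, ← ht, ← pow_mul, ← pow_add, ← pow_add,
      Nat.div_add_mod]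
  · refine GroupFun.exists_bialgEquiv (K := K) (E := E)
      (N := Multiplicative (ZMod n)) (A := ZMod n)
      { toFun := fun η => ψ.mulShift η.toAdd
        map_one' := ψ.mulShift_zero
        map_mul' := fun x y => (ψ.mulShift_mul x.toAdd y.toAdd).symm } ?_ rfl
    exact fun x y h => AddChar.to_mulShift_inj_of_isPrimitive hψ h

/-- The linear part of an affine map of `ZMod n`, transported to `Fin n`. -/
def affLin {n : ℕ} (e : Fin n ≃ ZMod n) (g : Equiv.Perm (Fin n)) : ZMod n :=
  e (g (e.symm 1)) - e (g (e.symm 0))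

/-- The translation part of an affine map of `ZMod n`, transported to `Fin n`. -/
def affTrans {n : ℕ} (e : Fin n ≃ ZMod n) (g : Equiv.Perm (Fin n)) : ZMod n :=
  e (g (e.symm 0))

namespace IsAffineVia

variable {n : ℕ} {G : Subgroup (Equiv.Perm (Fin n))} {e : Fin n ≃ ZMod n} (h : IsAffineVia G e)

include h

lemma apply_eq {g : Equiv.Perm (Fin n)} (hg : g ∈ G) (x : Fin n) :
    e (g x) = affLin e g * e x + affTrans e g := by
  obtain ⟨u, v, huv⟩ := h g hg
  simp only [affLin, affTrans, huv, Equiv.apply_symm_apply]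
  ring

lemma affTrans_mul {g g' : Equiv.Perm (Fin n)} (hg : g ∈ G) :
    affTrans e (g * g') = affLin e g * affTrans e g' + affTrans e g := by
  conv_lhs => rw [affTrans, Equiv.Perm.mul_apply, h.apply_eq hg]
  rfl

lemma affLin_mul {g g' : Equiv.Perm (Fin n)} (hg : g ∈ G) :
    affLin e (g * g') = affLin e g * affLin e g' := by
  rw [affLin, Equiv.Perm.mul_apply, Equiv.Perm.mul_apply, h.apply_eq hg, h.apply_eq hg]
  simp only [affLin]
  ring

omit h in
lemma _root_.affLin_one : affLin e 1 = 1 := by simp [affLin]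

lemma isUnit_affLin {g : Equiv.Perm (Fin n)} (hg : g ∈ G) : IsUnit (affLin e g) :=
  IsUnit.of_mul_eq_one (affLin e g⁻¹) (by rw [← h.affLin_mul hg, mul_inv_cancel, affLin_one])

end IsAffineVia

/-- The map x ↦ u x + v acts on E by ψ(a) ↦ ψ(u a), t ↦ ψ(v) t, which respects composition. With K
the fixed field and L = K(t), the fixing group of L is the stabiliser of the point labelled 0, so
cosets are points. -/
theorem RealisedByHopfGalois.of_isAffineVia {n : ℕ} [NeZero n] {G : Subgroup (Equiv.Perm (Fin n))}
    (htr : MulAction.IsPretransitive G (Fin n)) {e : Fin n ≃ ZMod n} (he : IsAffineVia G e) :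
    RealisedByHopfGalois.{u} n (Multiplicative (ZMod n)) G := by
  classical
  obtain ⟨E, _, ψ, t, hψ, ht, hex, huniq⟩ := exists_field_with_affine_automorphisms.{u} n
  have hΦ : ∀ g : G, ∃ φ : E ≃+* E, (∀ a, φ (ψ a) = ψ (affLin e g * a)) ∧
      φ t = ψ (affTrans e g) * t := fun g => hex (he.isUnit_affLin g.2).unit (affTrans e g)
  choose Φ₀ hΦψ hΦt using hΦ
  let Φ : G →* (E ≃+* E) := MonoidHom.mk' Φ₀ (by
    intro g g'
    refine huniq _ _ (fun a => ?_) ?_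
    · rw [hΦψ, RingAut.mul_apply, hΦψ, hΦψ, Subgroup.coe_mul, he.affLin_mul g.2, mul_assoc]
    · rw [hΦt, RingAut.mul_apply, hΦt, map_mul, hΦt, hΦψ, Subgroup.coe_mul, he.affTrans_mul g.2,
        AddChar.map_add_eq_mul, mul_assoc])
  have hψinj : Function.Injective ψ := fun a b hab =>
    AddChar.to_mulShift_inj_of_isPrimitive hψ (by
      ext x
      have hx : ∀ c, ψ (c * x) = ψ c ^ x.val := fun c => by
        rw [← AddChar.map_nsmul_eq_pow, nsmul_eq_mul, ZMod.natCast_zmod_val, mul_comm]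
      rw [AddChar.mulShift_apply, AddChar.mulShift_apply, hx, hx, hab])
  let _ : MulSemiringAction G E := MulSemiringAction.compHom E Φ
  have hsmul : ∀ (g : G) (y : E), g • y = Φ₀ g y := fun g y => rfl
  -- An affine map that fixes both t and ψ(1) has zero translation part and linear part 1. This
  -- gives faithfulness, and later shows that t and ψ(1) generate E over K.
  have hone : ∀ g : G, g • t = t → g • (ψ 1) = ψ 1 → g = 1 := by
    intro g h1 h2
    rw [hsmul, hΦt] at h1
    rw [hsmul, hΦψ] at h2
    have h3 : affTrans e g = 0 := hψinj (by
      rw [AddChar.map_zero_eq_one]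
      exact mul_right_cancel₀ ht (by rw [h1, one_mul]))
    have h4 := hψinj h2
    rw [mul_one] at h4
    ext x
    have := he.apply_eq g.2 x
    rw [h3, h4, one_mul, add_zero] at this
    rw [e.injective this]
    rfl
  have hfaith : FaithfulSMul G E := ⟨fun {g g'} h => by
    have : g'⁻¹ * g = 1 := hone _ (by rw [mul_smul, h, inv_smul_smul])
      (by rw [mul_smul, h, inv_smul_smul])
    rw [inv_mul_eq_one] at this
    exact this.symm⟩
  let K := FixedPoints.subfield G E
  let θ : G ≃* (E ≃ₐ[K] E) := FixedPoints.toAlgAutMulEquiv G E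
  have hθ : ∀ g y, θ g y = g • y := fun g y => rfl
  let L : IntermediateField K E := IntermediateField.adjoin K {t}
  let tL : L := IntermediateField.AdjoinSimple.gen K t
  have hmemL : ∀ g : G, θ g ∈ L.fixingSubgroup ↔ g • t = t := by
    intro g
    rw [IntermediateField.mem_fixingSubgroup_iff]
    refine ⟨fun h => h t (IntermediateField.mem_adjoin_simple_self K t), fun h x hx => ?_⟩
    induction hx using IntermediateField.adjoin_induction with
    | mem x hx => rw [Set.mem_singleton_iff.1 hx]; exact h
    | algebraMap x => exact AlgEquiv.commutes _ _
    | add x y _ _ hx hy => rw [map_add, hx, hy]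
    | mul x y _ _ hx hy => rw [map_mul, hx, hy]
    | inv x _ hx => rw [map_inv₀, hx]
  have htrans : ∀ v : ZMod n, ∃ g : G, affTrans e g = v := by
    intro v
    obtain ⟨g, hg⟩ := MulAction.exists_smul_eq G (e.symm 0) (e.symm v)
    refine ⟨g, ?_⟩
    rw [affTrans]
    exact (Equiv.symm_apply_eq e).1 hg.symm |>.symm
  have hstab : ∀ g : G, g • t = t ↔ g • (e.symm 0) = e.symm 0 := by
    intro g
    rw [hsmul, hΦt, ← e.injective.eq_iff]
    change _ ↔ affTrans e g = _
    rw [e.apply_symm_apply]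
    constructor
    · intro h1
      refine hψinj ?_
      rw [AddChar.map_zero_eq_one]
      exact mul_right_cancel₀ ht (by rw [h1, one_mul])
    · intro h1
      rw [h1, AddChar.map_zero_eq_one, one_mul]
  let r : (E ≃ₐ[K] E) ⧸ L.fixingSubgroup → Fin n :=
    Quotient.lift (fun σ => θ.symm σ • e.symm 0) (by
      intro a b hab
      have h1 := QuotientGroup.leftRel_apply.1 hab
      obtain ⟨g, rfl⟩ := θ.surjective a
      obtain ⟨g', rfl⟩ := θ.surjective b
      rw [← map_inv, ← map_mul, hmemL, hstab] at h1
      simp only [MulEquiv.symm_apply_apply]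
      rw [mul_smul, inv_smul_eq_iff] at h1
      exact h1.symm)
  have hrbij : Function.Bijective r := by
    constructor
    · rintro ⟨a⟩ ⟨b⟩ hab
      refine QuotientGroup.eq.2 ?_
      obtain ⟨g, rfl⟩ := θ.surjective a
      obtain ⟨g', rfl⟩ := θ.surjective b
      have hab' : θ.symm (θ g) • e.symm 0 = θ.symm (θ g') • e.symm 0 := hab
      rw [MulEquiv.symm_apply_apply, MulEquiv.symm_apply_apply] at hab'
      rw [← map_inv, ← map_mul, hmemL, hstab, mul_smul, inv_smul_eq_iff]
      exact hab'.symm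
    · intro x
      obtain ⟨g, hg⟩ := MulAction.exists_smul_eq G (e.symm 0) x
      exact ⟨QuotientGroup.mk (θ g), by
        change θ.symm (θ g) • e.symm 0 = x
        rw [MulEquiv.symm_apply_apply, hg]⟩
  have hfin : Module.finrank K L = n := by
    rw [IntermediateField.finrank_eq_fixingSubgroup_index, Subgroup.index,
      Nat.card_congr (Equiv.ofBijective r hrbij), Nat.card_eq_fintype_card, Fintype.card_fin]
  have hgal : IsGalois K E := inferInstance
  refine ⟨K, E, inferInstance, inferInstance, inferInstance, L,
    Algebra.isSeparable_tower_bot_of_isSeparable K L E, ?_, hfin,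
    ⟨θ.symm, Equiv.ofBijective r hrbij, ?_⟩, ?_⟩
  · refine Algebra.IsAlgebraic.isNormalClosure_iff.2 ⟨fun x => ?_, ?_⟩
    · rw [← minpoly.algebraMap_eq (algebraMap L E).injective]
      exact Normal.splits inferInstance _
    -- By transitivity all ψ(v) t are conjugates of t, so the normal closure contains t and the
    -- quotient ψ(1).
    · have hM : ∀ v, ψ v * t ∈ IntermediateField.normalClosure K L E := by
        intro v
        obtain ⟨g, hg⟩ := htrans v
        have h1 := (((θ g).toAlgHom.comp L.val).fieldRange_le_normalClosure) ⟨tL, rfl⟩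
        rwa [← hg, ← hΦt]
      have hMt : t ∈ IntermediateField.normalClosure K L E := by
        simpa [AddChar.map_zero_eq_one] using hM 0
      have hMψ : ψ 1 ∈ IntermediateField.normalClosure K L E := by
        have := div_mem (hM 1) hMt
        rwa [mul_div_cancel_right₀ _ ht] at this
      have hfix : (IntermediateField.normalClosure K L E).fixingSubgroup = ⊥ := by
        refine (Subgroup.eq_bot_iff_forall _).2 fun σ hσ => ?_
        obtain ⟨g, rfl⟩ := θ.surjective σ
        rw [IntermediateField.mem_fixingSubgroup_iff] at hσ
        rw [hone g (hσ t hMt) (hσ _ hMψ), map_one]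
      rw [← IsGalois.fixedField_fixingSubgroup (IntermediateField.normalClosure K L E), hfix,
        IntermediateField.fixedField_bot]
  · rintro σ ⟨τ⟩
    change θ.symm (σ * τ) • e.symm 0 = θ.symm σ • θ.symm τ • e.symm 0
    rw [map_mul, mul_smul]
  · have htn : ∀ g : G, g • t ^ n = t ^ n := by
      intro g
      rw [smul_pow', hsmul, hΦt, mul_pow, ← AddChar.map_nsmul_eq_pow, nsmul_eq_mul,
        CharP.cast_eq_zero, zero_mul, AddChar.map_zero_eq_one, one_mul]
    have hint : IsIntegral K t := Algebra.IsIntegral.isIntegral t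
    refine exists_hopfGaloisStructure_of_pow_mem ψ hψ tL ⟨t ^ n, htn⟩ (Subtype.ext ?_) ?_ hfin
    · rfl
    · rw [IntermediateField.minpoly_gen, ← IntermediateField.adjoin.finrank hint]
      exact hfin

lemma PermGroupIso.symm {G X H Y : Type*} [Group G] [MulAction G X] [Group H] [MulAction H Y]
    (h : PermGroupIso G X H Y) : PermGroupIso H Y G X := by
  obtain ⟨φ, e, h⟩ := h
  refine ⟨φ.symm, e.symm, fun g x => ?_⟩
  rw [Equiv.symm_apply_eq, h, MulEquiv.apply_symm_apply, Equiv.apply_symm_apply]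

lemma PermGroupIso.trans {G X H Y J Z : Type*} [Group G] [MulAction G X] [Group H] [MulAction H Y]
    [Group J] [MulAction J Z] (h : PermGroupIso G X H Y) (k : PermGroupIso H Y J Z) :
    PermGroupIso G X J Z := by
  obtain ⟨φ, e, h⟩ := h
  obtain ⟨ψ, f, k⟩ := k
  refine ⟨φ.trans ψ, e.trans f, fun g x => ?_⟩
  simp only [Equiv.trans_apply, MulEquiv.trans_apply, h, k]

lemma permGroupIso_map_permCongr {X Y : Type*} (e : X ≃ Y) (Γ : Subgroup (Equiv.Perm X)) :
    PermGroupIso Γ X (Γ.map (e.permCongrHom : Equiv.Perm X ≃* Equiv.Perm Y).toMonoidHom) Y := by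
  refine ⟨Γ.equivMapOfInjective _ (MulEquiv.injective _), e, fun g x => ?_⟩
  change e (g.1 x) = e.permCongrHom g.1 (e x)
  simp [Equiv.permCongrHom, Equiv.permCongr_apply]

/-! ### Affine permutations of a product of prime fields and their invariants -/

/-- The permutation `g` of the ring `R` is affine with linear part `u`. -/
def IsAff {R : Type*} [CommRing R] (g : Equiv.Perm R) (u : Rˣ) : Prop :=
  ∀ x, g x = u * x + g 0

namespace IsAff

variable {R : Type*} [CommRing R] {g h : Equiv.Perm R} {u u' : Rˣ}

lemma mul (hg : IsAff g u) (hh : IsAff h u') : IsAff (g * h) (u * u') := fun x => by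
  rw [Equiv.Perm.mul_apply, Equiv.Perm.mul_apply, hh x, hg, hg (h 0), Units.val_mul]
  ring

lemma mul_apply_zero (hg : IsAff g u) (h : Equiv.Perm R) : (g * h) 0 = u * h 0 + g 0 := by
  rw [Equiv.Perm.mul_apply, hg]

lemma one : IsAff (1 : Equiv.Perm R) 1 := fun x => by simp

lemma inv_apply_zero (hg : IsAff g u) : g⁻¹ 0 = -(↑u⁻¹ * g 0) := by
  apply g.injective
  rw [hg (-(↑u⁻¹ * g 0))]
  simp

lemma inv (hg : IsAff g u) : IsAff g⁻¹ u⁻¹ := fun x => by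
  apply g.injective
  rw [hg (_ + _), hg.inv_apply_zero]
  simp [mul_add]

lemma pow (hg : IsAff g u) (k : ℕ) : IsAff (g ^ k) (u ^ k) := by
  induction k with
  | zero => simpa using one
  | succ k ih => rw [pow_succ, pow_succ]; exact ih.mul hg

lemma unique (hg : IsAff g u) (hg' : IsAff g u') : u = u' := by
  ext
  simpa using (hg 1).symm.trans (hg' 1)

lemma ext (hg : IsAff g u) (hh : IsAff h u) (h0 : g 0 = h 0) : g = h :=
  Equiv.ext fun x => by rw [hg x, hh x, h0]

lemma addRight (w : R) : IsAff (Equiv.addRight w) 1 := fun x => by simp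

lemma eq_addRight (hg : IsAff g 1) : g = Equiv.addRight (g 0) := hg.ext (addRight _) (by simp)

lemma addRight_pow (w : R) (k : ℕ) : (Equiv.addRight w) ^ k = Equiv.addRight (k * w) := by
  induction k with
  | zero => ext; simp
  | succ k ih =>
    rw [pow_succ, ih]
    refine ((addRight _).mul (addRight w)).ext (by simpa using addRight (R := R) _) ?_
    simp; ring

lemma conj_addRight (hg : IsAff g u) (w : R) :
    g * Equiv.addRight w * g⁻¹ = Equiv.addRight (u * w) := by
  rw [mul_inv_eq_iff_eq_mul]
  refine (hg.mul (addRight w)).ext (by simpa using (addRight (R := R) _).mul hg) ?_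
  rw [hg.mul_apply_zero]
  simp [add_comm]

/-- The affine permutation `x ↦ u * x + v`. -/
def mk (u : Rˣ) (v : R) : Equiv.Perm R := u.mulLeft.trans (Equiv.addRight v)

lemma mk_apply (u : Rˣ) (v x : R) : mk u v x = u * x + v := rfl

lemma isAff_mk (u : Rˣ) (v : R) : IsAff (mk u v) u := fun x => by simp [mk_apply]

end IsAff

section PiRing

variable {ι : Type} [Fintype ι] [DecidableEq ι] {p : ι → ℕ} [hp : ∀ i, Fact (p i).Prime]
  (hinj : Function.Injective p)

include hinj in
-- By the Chinese remainder theorem every element of the ring is a natural number, so powers of one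
-- translation give all its ring multiples, in particular its projections to single coordinates.
lemma exists_natCast_eq_pi (w : ∀ i, ZMod (p i)) : ∃ k : ℕ, (k : ∀ i, ZMod (p i)) = w := by
  have hcop : Pairwise (Function.onFun Nat.Coprime p) := fun i j hij =>
    (Nat.coprime_primes (hp i).out (hp j).out).2 (hinj.ne hij)
  let e := ZMod.prodEquivPi p hcop
  have : NeZero (∏ i, p i) := ⟨Finset.prod_ne_zero_iff.2 fun i _ => (hp i).out.ne_zero⟩
  refine ⟨(e.symm w).val, ?_⟩
  rw [← map_natCast e, ZMod.natCast_zmod_val, RingEquiv.apply_symm_apply]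

variable (Γ : Subgroup (Equiv.Perm (∀ i, ZMod (p i))))

/-- The coordinates whose translations are missing from `Γ`. -/
def missing : Finset ι :=
  open Classical in Finset.univ.filter fun i => Equiv.addRight (Pi.single i 1) ∉ Γ

/-- The linear parts of the affine maps in `Γ`. -/
def linearParts : Subgroup (∀ i, ZMod (p i))ˣ where
  carrier := {u | ∃ g ∈ Γ, IsAff g u}
  one_mem' := ⟨1, Γ.one_mem, IsAff.one⟩
  mul_mem' := fun ⟨g, hg, h⟩ ⟨g', hg', h'⟩ => ⟨g * g', Γ.mul_mem hg hg', h.mul h'⟩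
  inv_mem' := fun ⟨g, hg, h⟩ => ⟨g⁻¹, Γ.inv_mem hg, h.inv⟩

/-- Transitive subgroups of the affine group of `∏ ZMod (p i)`. -/
structure IsAffTransitive : Prop where
  aff : ∀ g ∈ Γ, ∃ u, IsAff g u
  trans : ∀ x y, ∃ g ∈ Γ, g x = y

variable {Γ}

lemma mem_missing {i : ι} : i ∈ missing Γ ↔ Equiv.addRight (Pi.single i 1) ∉ Γ := by
  simp [missing]

include hinj in
lemma addRight_mem_of_smul {w : ∀ i, ZMod (p i)} (hw : Equiv.addRight w ∈ Γ)
    (c : ∀ i, ZMod (p i)) : Equiv.addRight (c * w) ∈ Γ := by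
  obtain ⟨k, rfl⟩ := exists_natCast_eq_pi hinj c
  rw [← IsAff.addRight_pow]
  exact Γ.pow_mem hw k

include hinj in
lemma notMem_missing_of_addRight_mem {w : ∀ i, ZMod (p i)} (hw : Equiv.addRight w ∈ Γ) {i : ι}
    (hi : w i ≠ 0) : i ∉ missing Γ := by
  rw [mem_missing, not_not]
  have := addRight_mem_of_smul hinj hw (Pi.single i (w i)⁻¹)
  rwa [← Pi.single_mul_left, inv_mul_cancel₀ hi] at this

include hinj in
-- Together with `notMem_missing_of_addRight_mem`: the translations in Γ are exactly those by
-- vectors that vanish on the missing coordinates.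
lemma addRight_mem_of_forall_missing {w : ∀ i, ZMod (p i)} (hw : ∀ i ∈ missing Γ, w i = 0) :
    Equiv.addRight w ∈ Γ := by
  have h1 : ∀ i, Equiv.addRight (Pi.single i (w i)) ∈ Γ := by
    intro i
    by_cases hi : i ∈ missing Γ
    · rw [hw i hi, Pi.single_zero, Equiv.addRight_zero]
      exact Γ.one_mem
    · rw [mem_missing, not_not] at hi
      have := addRight_mem_of_smul hinj hi (Pi.single i (w i))
      rwa [← Pi.single_mul_left, Pi.single_eq_same, mul_one] at this
  have h2 : ∀ s : Finset ι, Equiv.addRight (∑ i ∈ s, Pi.single i (w i)) ∈ Γ := by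
    intro s
    induction s using Finset.induction_on with
    | empty => simp [Γ.one_mem]
    | insert i s hi ih =>
      rw [Finset.sum_insert hi, Equiv.addRight_add]
      exact Γ.mul_mem (by first | exact h1 i | exact ih) (by first | exact ih | exact h1 i)
  have := h2 Finset.univ
  rwa [Finset.univ_sum_single] at this

namespace IsAffTransitive

variable (hΓ : IsAffTransitive Γ)
include hΓ hinj

/-- If u_i ≠ 1, then g has a unique fixed point in coordinate i. A commutator in Γ is a translation,
so on a missing coordinate it is trivial; thus every h in Γ commutes with g there and preserves that
fixed point, contradicting transitivity. -/
lemma linear_eq_one_of_mem_missing {i : ι} (hi : i ∈ missing Γ) {g : Equiv.Perm (∀ i, ZMod (p i))}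
    (hg : g ∈ Γ) {u} (hu : IsAff g u) : (u : ∀ i, ZMod (p i)) i = 1 := by
  by_contra hne
  have hne' : (u : ∀ i, ZMod (p i)) i - 1 ≠ 0 := sub_ne_zero.2 hne
  -- The i-th coordinate is the fixed point, the solution of u_i x + g(0)_i = x; h is then chosen to
  -- move it by 1.
  let x₀ : ∀ i, ZMod (p i) := Pi.single i (-(g 0 i) / ((u : ∀ i, ZMod (p i)) i - 1))
  obtain ⟨h, hh, hx⟩ := hΓ.trans x₀ (x₀ + Pi.single i 1)
  obtain ⟨u', hu'⟩ := hΓ.aff h hh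
  have hmem : (g * h) * (h * g)⁻¹ ∈ Γ :=
    Γ.mul_mem (Γ.mul_mem hg hh) (Γ.inv_mem (Γ.mul_mem hh hg))
  have haff : IsAff ((g * h) * (h * g)⁻¹) 1 := by
    have := (hu.mul hu').mul (hu'.mul hu).inv
    rwa [mul_comm u' u, mul_inv_cancel] at this
  rw [haff.eq_addRight] at hmem
  have h0 : ((g * h) * (h * g)⁻¹) 0 i = 0 := by
    by_contra hcon
    exact notMem_missing_of_addRight_mem hinj hmem hcon hi
  rw [(hu.mul hu').mul_apply_zero, (hu'.mul hu).inv_apply_zero, hu.mul_apply_zero,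
    hu'.mul_apply_zero, mul_comm u' u] at h0
  have h1 : ((u * u' : (∀ i, ZMod (p i))ˣ) : ∀ i, ZMod (p i)) *
      -(↑(u * u')⁻¹ * (u' * g 0 + h 0)) = - (u' * g 0 + h 0) := by
    rw [mul_neg, Units.mul_inv_cancel_left]
  rw [h1] at h0
  have hxi := congrFun hx i
  rw [hu' x₀] at hxi
  simp only [Pi.add_apply, Pi.mul_apply, Pi.neg_apply, Pi.single_eq_same, x₀] at hxi h0
  field_simp at hxi
  apply hne'
  linear_combination (-1 : ZMod (p i)) * hxi + h0

/-- A nontrivial element of order `p i` which generates a normal subgroup of `Γ` is a translation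
of the `i`-th coordinate. -/
lemma eq_addRight_single_of_normal {i : ι} {g : Equiv.Perm (∀ i, ZMod (p i))} (hg : g ∈ Γ)
    (hpow : g ^ p i = 1) (hnorm : ∀ h ∈ Γ, ∃ k : ℕ, h * g * h⁻¹ = g ^ k) :
    ∃ c, g = Equiv.addRight (Pi.single i c) := by
  obtain ⟨u, hu⟩ := hΓ.aff g hg
  have hu1 : ∀ j, j ≠ i → (u : ∀ i, ZMod (p i)) j = 1 := by
    intro j hj
    by_cases hjm : j ∈ missing Γ
    · exact hΓ.linear_eq_one_of_mem_missing hinj hjm hg hu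
    rw [mem_missing, not_not] at hjm
    obtain ⟨k, hk⟩ := hnorm _ hjm
    -- The commutator of the j-th unit translation with g is translation by (1 - u_j) e_j. By
    -- normality it is a power of g, so p_i kills it, and p_i ≠ p_j leaves only u_j = 1.
    have h1 : Equiv.addRight (Pi.single j 1) * g * (Equiv.addRight (Pi.single j 1))⁻¹ * g⁻¹ =
        Equiv.addRight ((1 - (u : ∀ i, ZMod (p i))) * Pi.single j 1) := by
      have h2 := hu.conj_addRight (-Pi.single j 1)
      have h3 : (Equiv.addRight (Pi.single j 1 : ∀ i, ZMod (p i)))⁻¹ =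
          Equiv.addRight (-Pi.single j 1) := by ext; simp [Equiv.Perm.inv_def]
      rw [mul_assoc, mul_assoc, ← mul_assoc g, h3, h2]
      ext x
      simp
      ring
    have h2 : (Equiv.addRight ((1 - (u : ∀ i, ZMod (p i))) * Pi.single j 1 : ∀ i, ZMod (p i))) ^ p i = 1 := by
      rw [← h1, hk, (((Commute.refl g).pow_left k).inv_right).mul_pow, ← pow_mul, mul_comm k, pow_mul,
        inv_pow, hpow, one_pow, inv_one, one_mul]
    rw [IsAff.addRight_pow] at h2
    have h3 := congrFun (DFunLike.congr_fun h2 0) j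
    simp only [Equiv.coe_addRight, Equiv.Perm.coe_one, id, zero_add, Pi.mul_apply, Pi.sub_apply,
      Pi.natCast_apply, Pi.single_eq_same, Pi.one_apply, mul_one, Pi.zero_apply, mul_eq_zero] at h3
    rcases h3 with h3 | h3
    · rw [ZMod.natCast_eq_zero_iff, Nat.prime_dvd_prime_iff_eq (hp j).out (hp i).out] at h3
      exact absurd (hinj h3) hj
    · exact (sub_eq_zero.1 h3).symm
  have hu' : u = 1 := by
    -- By Fermat u_i = u_i^{p_i}, so this settles the coordinate i as well.
    have h1 : u ^ p i = 1 := by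
      have := hu.pow (p i)
      rw [hpow] at this
      exact this.unique IsAff.one
    ext j
    by_cases hj : j = i
    · subst hj
      have := congrFun (congrArg Units.val h1) j
      simpa using this
    · simpa using hu1 j hj
  subst hu'
  refine ⟨g 0 i, ?_⟩
  rw [hu.eq_addRight, IsAff.addRight_pow] at hpow
  rw [hu.eq_addRight]
  congr 1
  ext j
  by_cases hj : j = i
  · subst hj; simp
  · have h3 := congrFun (DFunLike.congr_fun hpow 0) j
    simp only [Equiv.coe_addRight, Equiv.Perm.coe_one, id, zero_add, Pi.mul_apply,
      Pi.natCast_apply, Pi.zero_apply, mul_eq_zero] at h3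
    rcases h3 with h3 | h3
    · rw [ZMod.natCast_eq_zero_iff, Nat.prime_dvd_prime_iff_eq (hp j).out (hp i).out] at h3
      exact absurd (hinj h3) hj
    · rw [Pi.single_eq_of_ne hj]
      simpa using h3

variable {Γ' : Subgroup (Equiv.Perm (∀ i, ZMod (p i)))} (hΓ' : IsAffTransitive Γ')
include hΓ'

omit hΓ in
/-- A group isomorphism respects translations of the `i`-th coordinate. -/
lemma exists_map_addRight_single (hΓ : IsAffTransitive Γ) (φ : Γ ≃* Γ') {i : ι}
    (hi : Equiv.addRight (Pi.single i 1) ∈ Γ) :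
    ∃ c, c ≠ 0 ∧ (φ ⟨_, hi⟩ : Equiv.Perm (∀ i, ZMod (p i))) = Equiv.addRight (Pi.single i c) := by
  have h1 : (⟨_, hi⟩ : Γ) ^ p i = 1 := by
    refine Subtype.ext ?_
    rw [Subgroup.coe_pow, IsAff.addRight_pow]
    have : ((p i : ℕ) : ∀ i, ZMod (p i)) * Pi.single i 1 = 0 := by
      ext j
      by_cases hj : j = i
      · subst hj; simp
      · simp [hj]
    rw [this]
    exact Equiv.addRight_zero
  have h2 : ∀ h : Γ, ∃ k : ℕ, h * ⟨_, hi⟩ * h⁻¹ = (⟨_, hi⟩ : Γ) ^ k := by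
    intro h
    obtain ⟨u, hu⟩ := hΓ.aff h h.2
    obtain ⟨k, hk⟩ := exists_natCast_eq_pi hinj (u : ∀ i, ZMod (p i))
    refine ⟨k, Subtype.ext ?_⟩
    rw [Subgroup.coe_pow, IsAff.addRight_pow, hk]
    exact hu.conj_addRight _
  obtain ⟨c, hc⟩ := hΓ'.eq_addRight_single_of_normal hinj (g := φ ⟨_, hi⟩) (φ _).2
    (by rw [← Subgroup.coe_pow, ← map_pow, h1, map_one, Subgroup.coe_one]) (by
      intro h hh
      obtain ⟨h', hh'⟩ := φ.surjective ⟨h, hh⟩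
      obtain ⟨k, hk⟩ := h2 h'
      refine ⟨k, ?_⟩
      have := congrArg (fun x => (φ x : Equiv.Perm (∀ i, ZMod (p i)))) hk
      simp only [map_mul, map_inv, map_pow, hh', Subgroup.coe_mul, Subgroup.coe_inv,
        Subgroup.coe_pow] at this
      exact this)
  refine ⟨c, ?_, hc⟩
  rintro rfl
  rw [Pi.single_zero, Equiv.addRight_zero] at hc
  have h3 : φ ⟨_, hi⟩ = 1 := Subtype.ext hc
  rw [map_eq_one_iff φ φ.injective] at h3
  have h4 := congrFun (DFunLike.congr_fun (congrArg Subtype.val h3) 0) i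
  simp at h4

/-- Translations in coordinate i are recognised inside the abstract group: they generate a normal
subgroup of order p_i, and any element of Γ' with these properties is again such a translation. -/
lemma missing_eq (φ : Γ ≃* Γ') : missing Γ = missing Γ' := by
  ext i
  rw [← not_iff_not]
  constructor
  · intro hi
    rw [mem_missing, not_not] at hi
    obtain ⟨c, hc, hφ⟩ := exists_map_addRight_single hinj hΓ' hΓ φ hi
    refine notMem_missing_of_addRight_mem hinj (w := Pi.single i c) ?_ (by simpa using hc)
    rw [← hφ]; exact (φ _).2
  · intro hi
    rw [mem_missing, not_not] at hi
    obtain ⟨c, hc, hφ⟩ := exists_map_addRight_single hinj hΓ hΓ' φ.symm hi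
    refine notMem_missing_of_addRight_mem hinj (w := Pi.single i c) ?_ (by simpa using hc)
    rw [← hφ]; exact (φ.symm _).2

/-- On a missing coordinate both linear parts are 1. On another coordinate u_i is the exponent by
which conjugation acts on the translations of that coordinate, and φ preserves this. -/
lemma linear_eq (φ : Γ ≃* Γ') (g : Γ) {u u'} (hu : IsAff (g : Equiv.Perm (∀ i, ZMod (p i))) u)
    (hu' : IsAff (φ g : Equiv.Perm (∀ i, ZMod (p i))) u') : u = u' := by
  ext i
  by_cases hi : i ∈ missing Γ
  · rw [hΓ.linear_eq_one_of_mem_missing hinj hi g.2 hu]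
    rw [hΓ.missing_eq hinj hΓ' φ] at hi
    rw [hΓ'.linear_eq_one_of_mem_missing hinj hi (φ g).2 hu']
  · rw [mem_missing, not_not] at hi
    obtain ⟨c, hc, hφ⟩ := exists_map_addRight_single hinj hΓ' hΓ φ hi
    obtain ⟨k, hk⟩ := exists_natCast_eq_pi hinj (u : ∀ i, ZMod (p i))
    have h1 : g * ⟨_, hi⟩ * g⁻¹ = (⟨_, hi⟩ : Γ) ^ k := by
      refine Subtype.ext ?_
      rw [Subgroup.coe_pow, IsAff.addRight_pow, hk]
      exact hu.conj_addRight _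
    have h2 := congrArg (fun x => (φ x : Equiv.Perm (∀ i, ZMod (p i)))) h1
    simp only [map_mul, map_inv, map_pow, Subgroup.coe_mul, Subgroup.coe_inv, Subgroup.coe_pow,
      hφ] at h2
    rw [hu'.conj_addRight, IsAff.addRight_pow, hk] at h2
    have h3 := congrFun (DFunLike.congr_fun h2 0) i
    simp only [Equiv.coe_addRight, zero_add, Pi.mul_apply, Pi.single_eq_same] at h3
    exact (mul_right_cancel₀ hc h3).symm

lemma linearParts_eq (φ : Γ ≃* Γ') : linearParts Γ = linearParts Γ' := by
  ext u
  constructor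
  · rintro ⟨g, hg, hu⟩
    obtain ⟨u', hu'⟩ := hΓ'.aff _ (φ ⟨g, hg⟩).2
    rw [hΓ.linear_eq hinj hΓ' φ ⟨g, hg⟩ hu hu']
    exact ⟨_, (φ ⟨g, hg⟩).2, hu'⟩
  · rintro ⟨g, hg, hu⟩
    obtain ⟨u', hu'⟩ := hΓ.aff _ (φ.symm ⟨g, hg⟩).2
    rw [hΓ'.linear_eq hinj hΓ φ.symm ⟨g, hg⟩ hu hu']
    exact ⟨_, (φ.symm ⟨g, hg⟩).2, hu'⟩

omit hΓ' in
-- On a missing coordinate the elements of Γ act as pure translations, so the translation part is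
-- additive there.
lemma pow_apply_zero {i : ι} (hi : i ∈ missing Γ) {g : Equiv.Perm (∀ i, ZMod (p i))} (hg : g ∈ Γ)
    (k : ℕ) : (g ^ k) 0 i = k * g 0 i := by
  obtain ⟨u, hu⟩ := hΓ.aff g hg
  induction k with
  | zero => simp
  | succ k ih =>
    rw [pow_succ, (hu.pow k).mul_apply_zero, Pi.add_apply, ih, Pi.mul_apply,
      Units.val_pow_eq_pow_val, Pi.pow_apply, hΓ.linear_eq_one_of_mem_missing hinj hi hg hu]
    push_cast
    ring

omit hΓ' in
-- g^k is a translation in Γ with i-th component k · g(0)_i. It must vanish because i is missing,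
-- and k is invertible modulo p_i.
lemma apply_zero_eq_zero {i : ι} (hi : i ∈ missing Γ) {g : Equiv.Perm (∀ i, ZMod (p i))}
    (hg : g ∈ Γ) {u} (hu : IsAff g u) {k : ℕ} (hk : ¬ p i ∣ k) (huk : u ^ k = 1) :
    g 0 i = 0 := by
  have h2 := hu.pow k
  rw [huk] at h2
  have h3 : g ^ k ∈ Γ := Γ.pow_mem hg _
  rw [h2.eq_addRight] at h3
  by_contra hne
  refine notMem_missing_of_addRight_mem hinj h3 (i := i) ?_ hi
  rw [hΓ.pow_apply_zero hinj hi hg]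
  exact mul_ne_zero (by rwa [Ne, ZMod.natCast_eq_zero_iff]) hne

omit hΓ' in
lemma dvd_card_linearParts {i : ι} (hi : i ∈ missing Γ) : p i ∣ Nat.card (linearParts Γ) := by
  obtain ⟨g, hg, h0⟩ := hΓ.trans 0 (Pi.single i 1)
  obtain ⟨u, hu⟩ := hΓ.aff g hg
  by_contra hcon
  have h1 : u ^ Nat.card (linearParts Γ) = 1 := by
    have := pow_card_eq_one' (x := (⟨u, g, hg, hu⟩ : linearParts Γ))
    exact congrArg Subtype.val this
  have h2 := hΓ.apply_zero_eq_zero hinj hi hg hu hcon h1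
  rw [h0, Pi.single_eq_same] at h2
  exact one_ne_zero h2

end IsAffTransitive

end PiRing

/-! ### Normal forms and the classification by pairs -/

section PiRing

variable {ι : Type} [Fintype ι] [DecidableEq ι] {p : ι → ℕ} [hp : ∀ i, Fact (p i).Prime]

/-- The pairs which classify transitive groups of affine maps: missing translations and linear
parts. -/
def IsAffPair (I : Finset ι) (A : Subgroup (∀ i, ZMod (p i))ˣ) : Prop :=
  ∀ i ∈ I, (∀ a ∈ A, (a : ∀ i, ZMod (p i)) i = 1) ∧ p i ∣ Nat.card A

variable (ψ : ∀ i, (∀ i, ZMod (p i))ˣ →* Multiplicative (ZMod (p i)))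

/-- The standard transitive group of affine maps which belongs to a pair. -/
def stdAff {I : Finset ι} {A : Subgroup (∀ i, ZMod (p i))ˣ} (h : IsAffPair I A) :
    Subgroup (Equiv.Perm (∀ i, ZMod (p i))) where
  carrier := {g | ∃ u ∈ A, IsAff g u ∧ ∀ i ∈ I, g 0 i = (ψ i u).toAdd}
  one_mem' := ⟨1, A.one_mem, IsAff.one, fun i _ => by simp⟩
  mul_mem' := by
    rintro g g' ⟨u, hu, hg, h0⟩ ⟨u', hu', hg', h0'⟩
    refine ⟨u * u', A.mul_mem hu hu', hg.mul hg', fun i hi => ?_⟩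
    rw [hg.mul_apply_zero, Pi.add_apply, Pi.mul_apply, (h i hi).1 u hu, h0 i hi, h0' i hi, map_mul,
      toAdd_mul, one_mul, add_comm]
  inv_mem' := by
    rintro g ⟨u, hu, hg, h0⟩
    refine ⟨u⁻¹, A.inv_mem hu, hg.inv, fun i hi => ?_⟩
    rw [hg.inv_apply_zero, Pi.neg_apply, Pi.mul_apply, (h i hi).1 _ (A.inv_mem hu), h0 i hi, map_inv,
      toAdd_inv, one_mul]

variable (hinj : Function.Injective p) {M : ι → ℕ} (hM : ∀ i, ¬ p i ∣ M i)
  (hψ : ∀ i a, ψ i a = 1 → a ^ M i = 1)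

include hinj in
lemma IsAffTransitive.isAffPair {Γ : Subgroup (Equiv.Perm (∀ i, ZMod (p i)))}
    (hΓ : IsAffTransitive Γ) : IsAffPair (missing Γ) (linearParts Γ) := fun _ hi =>
  ⟨fun _ ⟨_, hg, hu⟩ => hΓ.linear_eq_one_of_mem_missing hinj hi hg hu,
    hΓ.dvd_card_linearParts hinj hi⟩

include hinj hM hψ in
-- The kernel of ψ_i has exponent dividing M_i, prime to p_i, so by `apply_zero_eq_zero` the
-- translation part vanishes wherever ψ_i does. Two homomorphisms to ℤ/p_i so related are
-- proportional.
lemma IsAffTransitive.exists_scalar {Γ : Subgroup (Equiv.Perm (∀ i, ZMod (p i)))}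
    (hΓ : IsAffTransitive Γ) {i : ι} (hi : i ∈ missing Γ) :
    ∃ c : (ZMod (p i))ˣ, ∀ g ∈ Γ, ∀ u, IsAff g u → c * g 0 i = (ψ i u).toAdd := by
  obtain ⟨g₁, hg₁, h₁⟩ := hΓ.trans 0 (Pi.single i 1)
  obtain ⟨u₁, hu₁⟩ := hΓ.aff g₁ hg₁
  have hs : (ψ i u₁).toAdd ≠ 0 := by
    intro hs
    have := hΓ.apply_zero_eq_zero hinj hi hg₁ hu₁ (hM i) (hψ i _ hs)
    rw [h₁, Pi.single_eq_same] at this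
    exact one_ne_zero this
  refine ⟨Units.mk0 _ hs, fun g hg u hu => ?_⟩
  -- The exponent is chosen to bring the linear part of g g₁^k into the kernel of ψ_i.
  let k := (-(ψ i u).toAdd / (ψ i u₁).toAdd).val
  have h2 : ψ i (u * u₁ ^ k) = 1 := by
    apply Multiplicative.toAdd.injective
    rw [map_mul, map_pow, toAdd_mul, toAdd_pow, nsmul_eq_mul, ZMod.natCast_zmod_val,
      div_mul_cancel₀ _ hs, add_neg_cancel, toAdd_one]
  have h3 := hΓ.apply_zero_eq_zero hinj hi (Γ.mul_mem hg (Γ.pow_mem hg₁ k)) (hu.mul (hu₁.pow k))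
    (hM i) (hψ i _ h2)
  rw [hu.mul_apply_zero, Pi.add_apply, Pi.mul_apply,
    hΓ.linear_eq_one_of_mem_missing hinj hi hg hu, hΓ.pow_apply_zero hinj hi hg₁, h₁,
    Pi.single_eq_same, ZMod.natCast_zmod_val] at h3
  rw [Units.val_mk0]
  field_simp at h3
  linear_combination h3

include hinj hM hψ in
-- Conjugation by a diagonal unit keeps linear parts and rescales the translation parts, so it can
-- turn each of them on a missing coordinate into ψ_i.
lemma IsAffTransitive.permGroupIso_stdAff {Γ : Subgroup (Equiv.Perm (∀ i, ZMod (p i)))}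
    (hΓ : IsAffTransitive Γ) :
    PermGroupIso Γ (∀ i, ZMod (p i)) (stdAff ψ (hΓ.isAffPair hinj)) (∀ i, ZMod (p i)) := by
  have hc : ∀ i, ∃ c : (ZMod (p i))ˣ, i ∈ missing Γ → ∀ g ∈ Γ, ∀ u, IsAff g u →
      c * g 0 i = (ψ i u).toAdd := by
    intro i
    by_cases hi : i ∈ missing Γ
    · obtain ⟨c, hc⟩ := hΓ.exists_scalar ψ hinj hM hψ hi
      exact ⟨c, fun _ => hc⟩
    · exact ⟨1, fun h => absurd h hi⟩
  choose c hc using hc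
  let C : (∀ i, ZMod (p i))ˣ := MulEquiv.piUnits.symm c
  have hC : ∀ i, (C : ∀ i, ZMod (p i)) i = c i := fun i => rfl
  let e : (∀ i, ZMod (p i)) ≃ (∀ i, ZMod (p i)) := C.mulLeft
  have he : ∀ x, e x = C * x := fun x => rfl
  have hes : ∀ x, e.symm x = ↑C⁻¹ * x := fun x => rfl
  have hconj : ∀ g u, IsAff g u → IsAff (e.permCongrHom g) u ∧ e.permCongrHom g 0 = C * g 0 := by
    intro g u hg
    have h1 : ∀ x, e.permCongrHom g x = e (g (e.symm x)) := fun x => rfl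
    have h2 : e.permCongrHom g 0 = C * g 0 := by rw [h1, hes, he, mul_zero]
    refine ⟨fun x => ?_, h2⟩
    rw [h2, h1, hes, he, hg, mul_add, mul_left_comm, Units.mul_inv_cancel_left]
  have hmap : Γ.map (e.permCongrHom : _ ≃* _).toMonoidHom = stdAff ψ (hΓ.isAffPair hinj) := by
    ext g
    constructor
    · rintro ⟨g, hg, rfl⟩
      obtain ⟨u, hu⟩ := hΓ.aff g hg
      refine ⟨u, ⟨g, hg, hu⟩, (hconj g u hu).1, fun i hi => ?_⟩
      rw [← hc i hi g hg u hu, ← hC, ← Pi.mul_apply]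
      exact congrFun (hconj g u hu).2 i
    · rintro ⟨u, ⟨g₁, hg₁, hu₁⟩, hu, h0⟩
      have h1 := hconj g₁ u hu₁
      -- Two affine maps with the same linear part differ by a translation; this one vanishes on the
      -- missing coordinates, so it lies in Γ.
      have hw : Equiv.addRight (↑C⁻¹ * g 0 - g₁ 0) ∈ Γ := by
        refine addRight_mem_of_forall_missing hinj fun i hi => ?_
        have h2 : (C * (↑C⁻¹ * g 0 - g₁ 0) : ∀ i, ZMod (p i)) i = 0 := by
          rw [mul_sub, Units.mul_inv_cancel_left, Pi.sub_apply, h0 i hi, Pi.mul_apply, hC,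
            hc i hi g₁ hg₁ u hu₁, sub_self]
        rw [Pi.mul_apply, hC] at h2
        exact (Units.mul_right_eq_zero _).1 h2
      refine ⟨_, Γ.mul_mem hw hg₁, ?_⟩
      have h3 : IsAff (Equiv.addRight (↑C⁻¹ * g 0 - g₁ 0) * g₁) u := by
        simpa using (IsAff.addRight (↑C⁻¹ * g 0 - g₁ 0)).mul hu₁
      refine (hconj _ u h3).1.ext hu ((hconj _ u h3).2.trans ?_)
      simp
  have := permGroupIso_map_permCongr e Γ
  rwa [hmap] at this

include hinj hM hψ in
-- Cauchy's theorem gives elements of A of order p_i, on which ψ_i is nonzero because p_i does not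
-- divide M_i. Powers of them reach every prescribed value on I; the other coordinates are
-- unconstrained.
lemma isAffTransitive_stdAff {I : Finset ι} {A : Subgroup (∀ i, ZMod (p i))ˣ} (h : IsAffPair I A) :
    IsAffTransitive (stdAff ψ h) := by
  have ha : ∀ i, ∃ a ∈ A, i ∈ I → (ψ i a).toAdd ≠ 0 := by
    intro i
    by_cases hi : i ∈ I
    · obtain ⟨a, ha⟩ := exists_prime_orderOf_dvd_card' (p i) (h i hi).2
      refine ⟨a, a.2, fun _ h0 => hM i ?_⟩
      rw [← ha]
      exact orderOf_dvd_of_pow_eq_one (Subtype.ext (hψ i a h0))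
    · exact ⟨1, A.one_mem, fun h => absurd h hi⟩
  choose a haA ha using ha
  have hbase : ∀ x, ∃ g ∈ stdAff ψ h, g 0 = x := by
    intro x
    -- The exponent is x_i / ψ_i(a_i) modulo p_i and 0 modulo the other primes, so the factors do
    -- not disturb each other.
    have hN : ∀ i, ∃ k : ℕ, (k : ∀ i, ZMod (p i)) = Pi.single i (x i / (ψ i (a i)).toAdd) :=
      fun i => exists_natCast_eq_pi hinj _
    choose N hN using hN
    have hu : ∏ i, a i ^ N i ∈ A := A.prod_mem fun i _ => A.pow_mem (haA i) _
    refine ⟨IsAff.mk (∏ i, a i ^ N i) x, ⟨_, hu, IsAff.isAff_mk _ _, fun j hj => ?_⟩, ?_⟩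
    · rw [IsAff.mk_apply, mul_zero, zero_add, map_prod, toAdd_prod, Finset.sum_eq_single j]
      · have := congrFun (hN j) j
        rw [Pi.natCast_apply, Pi.single_eq_same] at this
        rw [map_pow, toAdd_pow, nsmul_eq_mul, this, div_mul_cancel₀ _ (ha j hj)]
      · intro i _ hij
        have := congrFun (hN i) j
        rw [Pi.natCast_apply, Pi.single_eq_of_ne hij.symm] at this
        rw [map_pow, toAdd_pow, nsmul_eq_mul, this, zero_mul]
      · simp
    · rw [IsAff.mk_apply, mul_zero, zero_add]
  refine ⟨fun g ⟨u, _, hg, _⟩ => ⟨u, hg⟩, fun x y => ?_⟩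
  obtain ⟨g, hg, hgx⟩ := hbase x
  obtain ⟨g', hg', hgy⟩ := hbase y
  refine ⟨g' * g⁻¹, Subgroup.mul_mem _ hg' (Subgroup.inv_mem _ hg), ?_⟩
  rw [← hgx, ← Equiv.Perm.mul_apply, inv_mul_cancel_right, hgy]

lemma missing_stdAff {I : Finset ι} {A : Subgroup (∀ i, ZMod (p i))ˣ} (h : IsAffPair I A) :
    missing (stdAff ψ h) = I := by
  ext i
  rw [mem_missing, not_iff_comm]
  constructor
  · intro hi
    refine ⟨1, A.one_mem, IsAff.addRight _, fun j hj => ?_⟩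
    have : j ≠ i := fun h => hi (h ▸ hj)
    simp [this]
  · rintro ⟨u, hu, hg, h0⟩ hi
    obtain rfl := hg.unique (IsAff.addRight _)
    have := h0 i hi
    simp at this

lemma linearParts_stdAff {I : Finset ι} {A : Subgroup (∀ i, ZMod (p i))ˣ} (h : IsAffPair I A) :
    linearParts (stdAff ψ h) = A := by
  ext u
  constructor
  · rintro ⟨g, ⟨u', hu', hg', -⟩, hu⟩
    rwa [hu.unique hg']
  · intro hu
    refine ⟨IsAff.mk u (fun i => (ψ i u).toAdd), ⟨u, hu, IsAff.isAff_mk _ _, fun i _ => ?_⟩,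
      IsAff.isAff_mk _ _⟩
    rw [IsAff.mk_apply, mul_zero, zero_add]

include hinj hM hψ in
/-- Permutation groups realised by Hopf–Galois structures of cyclic type are classified by pairs. -/
theorem numRealisedTypes_eq_card {n : ℕ} (hn : n = ∏ i, p i) :
    numRealisedTypes.{u} n (Multiplicative (ZMod n)) =
      Nat.card {x : Finset ι × Subgroup (∀ i, ZMod (p i))ˣ // IsAffPair x.1 x.2} := by
  have hn0 : NeZero n := ⟨by rw [hn]; exact Finset.prod_ne_zero_iff.2 fun i _ => (hp i).out.ne_zero⟩
  have hcop : Pairwise (Function.onFun Nat.Coprime p) := fun i j hij =>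
    (Nat.coprime_primes (hp i).out (hp j).out).2 (hinj.ne hij)
  let ρ : ZMod n ≃+* (∀ i, ZMod (p i)) := (ZMod.ringEquivCongr hn).trans (ZMod.prodEquivPi p hcop)
  let e₀ : Fin n ≃ (∀ i, ZMod (p i)) :=
    (Fintype.equivOfCardEq (by rw [Fintype.card_fin, ZMod.card])).trans ρ.toEquiv
  let Γ (x : {x : Finset ι × Subgroup (∀ i, ZMod (p i))ˣ // IsAffPair x.1 x.2}) :
      Subgroup (Equiv.Perm (Fin n)) :=
    (stdAff ψ x.2).map (e₀.symm.permCongrHom : _ ≃* _).toMonoidHom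
  have hΓiso : ∀ x, PermGroupIso (stdAff ψ x.2) (∀ i, ZMod (p i)) (Γ x) (Fin n) := fun x =>
    permGroupIso_map_permCongr e₀.symm _
  let F (x : {x : Finset ι × Subgroup (∀ i, ZMod (p i))ˣ // IsAffPair x.1 x.2}) :
    Quotient (permGroupSetoid n) := ⟦Γ x⟧
  have hF : Function.Injective F := by
    intro x y hxy
    have h1 : PermGroupIso (Γ x) (Fin n) (Γ y) (Fin n) := Quotient.exact hxy
    -- Only the abstract group isomorphism is needed to recover the pair.
    obtain ⟨φ, -, -⟩ := ((hΓiso x).trans h1).trans (hΓiso y).symm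
    have hx := isAffTransitive_stdAff ψ hinj hM hψ x.2
    have hy := isAffTransitive_stdAff ψ hinj hM hψ y.2
    have h2 := hx.missing_eq hinj hy φ
    have h3 := hx.linearParts_eq hinj hy φ
    rw [missing_stdAff, missing_stdAff] at h2
    rw [linearParts_stdAff, linearParts_stdAff] at h3
    exact Subtype.ext (Prod.ext h2 h3)
  have hrange : (fun G => (⟦G⟧ : Quotient (permGroupSetoid n))) ''
      {G | RealisedByHopfGalois.{u} n (Multiplicative (ZMod n)) G} = Set.range F := by
    ext q
    constructor
    · rintro ⟨G, hG, rfl⟩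
      obtain ⟨htr, e, he⟩ := RealisedByHopfGalois.exists_isAffineVia hG
      let e' : Fin n ≃ (∀ i, ZMod (p i)) := e.trans ρ.toEquiv
      have hiso := permGroupIso_map_permCongr e' G
      have he' : ∀ g x, e'.permCongrHom g x = e' (g (e'.symm x)) := fun g x => rfl
      have haff : IsAffTransitive (G.map (e'.permCongrHom : _ ≃* _).toMonoidHom) := by
        constructor
        · rintro _ ⟨g, hg, rfl⟩
          have h1 : ∀ x, e'.permCongrHom g x = ρ (affLin e g) * x + ρ (affTrans e g) := by
            intro x
            rw [he']
            change ρ (e (g (e.symm (ρ.symm x)))) = _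
            rw [he.apply_eq hg, map_add, map_mul, e.apply_symm_apply, ρ.apply_symm_apply]
          refine ⟨(he.isUnit_affLin hg).unit.map ρ, fun x => ?_⟩
          refine (h1 x).trans ?_
          have h2 := h1 0
          rw [mul_zero, zero_add] at h2
          rw [← h2]
          rfl
        · intro x y
          obtain ⟨g, hg⟩ := MulAction.exists_smul_eq G (e'.symm x) (e'.symm y)
          refine ⟨_, ⟨g, g.2, rfl⟩, ?_⟩
          refine (he' g x).trans ?_
          rw [← e'.eq_symm_apply]
          exact hg
      refine ⟨⟨(missing _, linearParts _), haff.isAffPair hinj⟩, Quotient.sound ?_⟩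
      exact (hiso.trans ((haff.permGroupIso_stdAff ψ hinj hM hψ).trans (hΓiso ⟨(missing _, linearParts _), haff.isAffPair hinj⟩))).symm
    · rintro ⟨x, rfl⟩
      have hx := isAffTransitive_stdAff ψ hinj hM hψ x.2
      have hmem : ∀ g, e₀.symm.permCongrHom g ∈ Γ x ↔ g ∈ stdAff ψ x.2 := fun g => by
        simp [Γ]
      have he₀ : ∀ g y, e₀.symm.permCongrHom g y = e₀.symm (g (e₀ y)) := fun g y => rfl
      refine ⟨Γ x, RealisedByHopfGalois.of_isAffineVia (e := e₀.trans ρ.symm.toEquiv) ⟨fun a b => ?_⟩ ?_, rfl⟩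
      · obtain ⟨g, hg, hgab⟩ := hx.trans (e₀ a) (e₀ b)
        refine ⟨⟨e₀.symm.permCongrHom g, (hmem g).2 hg⟩, ?_⟩
        refine (he₀ g a).trans ?_
        rw [hgab, e₀.symm_apply_apply]
      · rintro _ ⟨g, hg, rfl⟩
        obtain ⟨u, hu⟩ := hx.aff g hg
        refine ⟨ρ.symm u, ρ.symm (g 0), fun y => ?_⟩
        have h1 : ρ.symm (e₀ (e₀.symm (g (e₀ y)))) = ρ.symm u * ρ.symm (e₀ y) + ρ.symm (g 0) := by
          rw [e₀.apply_symm_apply, hu, map_add, map_mul]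
        exact (congrArg (fun z => ρ.symm (e₀ z)) (he₀ g y)).trans h1
  rw [numRealisedTypes, hrange, ← Set.image_univ, Set.ncard_image_of_injective _ hF, Set.ncard_univ]

end PiRing

/-! ### Counting subgroups of C_2^m and C_2^m × C_{2^x} -/

section CountSubgroups

open Classical in
/-- The sum of `f (|U|)` over the subgroups `U` of a finite group. -/
def sumSubgroups (V : Type*) [AddGroup V] [Finite V] (f : ℕ → ℚ) : ℚ :=
  letI := Fintype.ofFinite (AddSubgroup V)
  ∑ U : AddSubgroup V, f (Nat.card U)

lemma sumSubgroups_eq (V : Type*) [AddGroup V] [Finite V] [Fintype (AddSubgroup V)] (f : ℕ → ℚ) :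
    sumSubgroups V f = ∑ U : AddSubgroup V, f (Nat.card U) := by
  unfold sumSubgroups
  congr!

lemma sumSubgroups_congr {V V' : Type*} [AddGroup V] [Finite V] [AddGroup V'] [Finite V']
    (e : V ≃+ V') (f : ℕ → ℚ) : sumSubgroups V f = sumSubgroups V' f := by
  have := Fintype.ofFinite (AddSubgroup V)
  have := Fintype.ofFinite (AddSubgroup V')
  rw [sumSubgroups_eq, sumSubgroups_eq]
  refine Fintype.sum_equiv e.mapAddSubgroup.toEquiv _ _ fun U => ?_
  congr 1
  exact Nat.card_congr (U.equivMapOfInjective (e : V →+ V') e.injective).toEquiv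

lemma sumSubgroups_one (V : Type*) [AddGroup V] [Finite V] :
    sumSubgroups V (fun _ => 1) = Nat.card (AddSubgroup V) := by
  have := Fintype.ofFinite (AddSubgroup V)
  rw [sumSubgroups_eq]
  simp

variable {V Z : Type*} [AddCommGroup V] [AddCommGroup Z]

/-- The subgroups of `V × Z` which contain some `(v, g)`, where `g` generates `Z`, are given by a
subgroup of `V` and an element of the quotient. -/
def graphSubgroup (g : Z) (W : AddSubgroup V) (c : V ⧸ W) : AddSubgroup (V × Z) where
  carrier := {y | ∃ k : ℤ, y.2 = k • g ∧ (y.1 : V ⧸ W) = k • c}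
  zero_mem' := ⟨0, by simp⟩
  add_mem' := by
    rintro a b ⟨k, hk, hk'⟩ ⟨m, hm, hm'⟩
    exact ⟨k + m, by rw [Prod.snd_add, hk, hm, add_smul], by
      rw [Prod.fst_add, QuotientAddGroup.mk_add, hk', hm', add_smul]⟩
  neg_mem' := by
    rintro a ⟨k, hk, hk'⟩
    exact ⟨-k, by rw [Prod.snd_neg, hk, neg_smul], by
      rw [Prod.fst_neg, QuotientAddGroup.mk_neg, hk', neg_smul]⟩

variable (g : Z) (hg : ∀ z, z ∈ AddSubgroup.zmultiples g)
  (hkill : ∀ k : ℤ, k • g = 0 → ∀ v : V, k • v = 0)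

include hkill in
-- `hkill` makes k • c depend only on k • g, so the graph meets V in W and nothing more.
lemma comap_inl_graphSubgroup (W : AddSubgroup V) (c : V ⧸ W) :
    (graphSubgroup g W c).comap (AddMonoidHom.inl V Z) = W := by
  ext v
  constructor
  · rintro ⟨k, hk, hk'⟩
    obtain ⟨w, rfl⟩ := QuotientAddGroup.mk_surjective c
    have h1 : k • w = 0 := hkill k hk.symm w
    rw [← QuotientAddGroup.mk_zsmul, h1, QuotientAddGroup.mk_zero] at hk'
    exact (QuotientAddGroup.eq_zero_iff v).1 hk'
  · intro hv
    exact ⟨0, by simp, by simpa using (QuotientAddGroup.eq_zero_iff v).2 hv⟩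

/-- Subgroups of `V × Z` which surject onto the cyclic group `Z`. -/
def graphSubgroupEquiv :
    (Σ W : AddSubgroup V, V ⧸ W) ≃ {U : AddSubgroup (V × Z) // ∃ v, (v, g) ∈ U} := by
  refine Equiv.ofBijective (fun x => ⟨graphSubgroup g x.1 x.2, ?_⟩) ⟨?_, ?_⟩
  · obtain ⟨v, hv⟩ := QuotientAddGroup.mk_surjective x.2
    exact ⟨v, 1, by simp, by simpa using hv⟩
  · rintro ⟨W, c⟩ ⟨W', c'⟩ h
    have h1 : graphSubgroup g W c = graphSubgroup g W' c' := congrArg Subtype.val h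
    have h2 : W = W' := by
      rw [← comap_inl_graphSubgroup g hkill W c, h1, comap_inl_graphSubgroup g hkill]
    subst h2
    obtain ⟨v, rfl⟩ := QuotientAddGroup.mk_surjective c
    have h3 : (v, g) ∈ graphSubgroup g W c' := h1 ▸ ⟨1, by simp, by simp⟩
    obtain ⟨k, hk, hk'⟩ := h3
    obtain ⟨v', rfl⟩ := QuotientAddGroup.mk_surjective c'
    have h4 : (k - 1) • v' = 0 := hkill _ (by rw [sub_smul, ← hk, one_smul, sub_self]) v'
    rw [sub_smul, one_smul, sub_eq_zero] at h4
    rw [← QuotientAddGroup.mk_zsmul, h4] at hk'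
    exact congrArg _ hk'
  · rintro ⟨U, v, hv⟩
    refine ⟨⟨U.comap (AddMonoidHom.inl V Z), (v : V ⧸ _)⟩, Subtype.ext ?_⟩
    ext ⟨a, b⟩
    constructor
    · rintro ⟨k, hk, hk'⟩
      rw [← QuotientAddGroup.mk_zsmul, QuotientAddGroup.eq] at hk'
      have h1 := U.sub_mem (U.zsmul_mem hv k) (AddSubgroup.mem_comap.1 hk')
      simp only at hk
      simpa [hk] using h1
    · intro hab
      obtain ⟨k, hk⟩ := AddSubgroup.mem_zmultiples_iff.1 (hg b)
      refine ⟨k, hk.symm, ?_⟩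
      rw [← QuotientAddGroup.mk_zsmul, QuotientAddGroup.eq]
      have h1 := U.sub_mem (U.zsmul_mem hv k) hab
      refine AddSubgroup.mem_comap.2 ?_
      simpa [hk, sub_eq_add_neg, add_comm] using h1

include hg in
lemma card_eq_of_mem [Finite V] [Finite Z] {U : AddSubgroup (V × Z)} (hU : ∃ v, (v, g) ∈ U) :
    Nat.card U = Nat.card (U.comap (AddMonoidHom.inl V Z)) * Nat.card Z := by
  obtain ⟨v, hv⟩ := hU
  let π : U →+ Z := (AddMonoidHom.snd V Z).comp U.subtype
  have hπ : Function.Surjective π := by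
    intro z
    obtain ⟨k, rfl⟩ := AddSubgroup.mem_zmultiples_iff.1 (hg z)
    exact ⟨k • ⟨_, hv⟩, by simp [π]⟩
  have h1 := AddSubgroup.card_eq_card_quotient_mul_card_addSubgroup π.ker
  have h2 := Nat.card_congr (QuotientAddGroup.quotientKerEquivOfSurjective π hπ).toEquiv
  rw [h1, h2, mul_comm]
  congr 1
  refine Nat.card_congr ⟨fun y => ⟨y.1.1.1, ?_⟩, fun y => ⟨⟨(y.1, 0), y.2⟩, rfl⟩, ?_, ?_⟩
  · have h3 : y.1.1.2 = 0 := y.2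
    have h4 := y.1.2
    refine AddSubgroup.mem_comap.2 ?_
    rw [← Prod.mk.eta (p := y.1.1), h3] at h4
    exact h4
  · intro y
    have h3 : y.1.1.2 = 0 := y.2
    exact Subtype.ext (Subtype.ext (Prod.ext rfl h3.symm))
  · intro y
    rfl

include hg hkill in
/-- Recursion for subgroups of `V × Z`, where `Z` is a cyclic group with a unique maximal
subgroup `Z'`. -/
lemma sumSubgroups_prod [Finite V] [Finite Z] [Fintype (AddSubgroup V)] (Z' : AddSubgroup Z)
    (hgZ : g ∉ Z') (hZ : ∀ z, z ∉ Z' → g ∈ AddSubgroup.zmultiples z) (f : ℕ → ℚ) :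
    sumSubgroups (V × Z) f = sumSubgroups (V × Z') f +
      ∑ W : AddSubgroup V, (Nat.card (V ⧸ W) : ℚ) * f (Nat.card W * Nat.card Z) := by
  classical
  have := Fintype.ofFinite (AddSubgroup (V × Z))
  have := Fintype.ofFinite (AddSubgroup (V × Z'))
  have : ∀ W : AddSubgroup V, Fintype (V ⧸ W) := fun W => Fintype.ofFinite _
  rw [sumSubgroups_eq, sumSubgroups_eq,
    ← Fintype.sum_subtype_add_sum_subtype (fun U : AddSubgroup (V × Z) => ∃ v, (v, g) ∈ U), add_comm]
  congr 1
  · let j : V × Z' →+ V × Z := AddMonoidHom.prodMap (AddMonoidHom.id V) Z'.subtype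
    have hj : Function.Injective j := Function.injective_id.prodMap Z'.subtype_injective
    refine (Fintype.sum_equiv (Equiv.ofBijective (fun U' : AddSubgroup (V × Z') =>
      (⟨U'.map j, ?_⟩ : {U : AddSubgroup (V × Z) // ¬ ∃ v, (v, g) ∈ U})) ⟨?_, ?_⟩) _ _
        fun U' => ?_).symm
    · rintro ⟨v, ⟨v', z⟩, -, h⟩
      have h1 : (z : Z) = g := congrArg Prod.snd h
      exact hgZ (h1 ▸ z.2)
    · intro U₁ U₂ h
      exact AddSubgroup.map_injective hj (congrArg Subtype.val h)
    · rintro ⟨U, hU⟩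
      refine ⟨U.comap j, Subtype.ext (AddSubgroup.map_comap_eq_self ?_)⟩
      rintro ⟨v, z⟩ hvz
      -- An element outside Z' generates g, so a multiple of (v, z) would have second component g.
      have hz : z ∈ Z' := by
        by_contra hz
        obtain ⟨k, hk⟩ := AddSubgroup.mem_zmultiples_iff.1 (hZ z hz)
        exact hU ⟨k • v, by simpa [hk] using U.zsmul_mem hvz k⟩
      exact ⟨(v, ⟨z, hz⟩), rfl⟩
    · congr 1
      exact Nat.card_congr (U'.equivMapOfInjective j hj).toEquiv
  · rw [← (graphSubgroupEquiv g hg hkill).sum_comp, Fintype.sum_sigma]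
    refine Finset.sum_congr rfl fun W _ => ?_
    rw [Finset.sum_congr rfl (g := fun _ => f (Nat.card W * Nat.card Z)), Finset.sum_const,
      Finset.card_univ, nsmul_eq_mul, Nat.card_eq_fintype_card (α := V ⧸ W)]
    intro c _
    congr 1
    rw [card_eq_of_mem g hg (graphSubgroupEquiv g hg hkill ⟨W, c⟩).2]
    congr 2
    have : ((graphSubgroupEquiv g hg hkill ⟨W, c⟩).1).comap (AddMonoidHom.inl V Z) = W :=
      comap_inl_graphSubgroup g hkill W c
    rw [this]

/-- The number of subgroups of `V × Z`, with `V` elementary abelian and `Z` cyclic of order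
`2 ^ x`. -/
lemma card_addSubgroup_prod [Finite V] [Fintype (AddSubgroup V)] (hV : ∀ v : V, v + v = 0) (x : ℕ)
    (Z : Type) [AddCommGroup Z] [IsAddCyclic Z] (hZ : Nat.card Z = 2 ^ x) :
    (Nat.card (AddSubgroup (V × Z)) : ℚ) =
      ∑ W : AddSubgroup V, (x * (Nat.card (V ⧸ W) : ℚ) + 1) := by
  induction x generalizing Z with
  | zero => 
    have : Finite Z := Nat.finite_of_card_ne_zero (by rw [hZ]; simp)
    have : Subsingleton Z := (Nat.card_eq_one_iff_unique.1 (by simpa using hZ)).1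
    have e : V × Z ≃+ V := 
      { toFun := Prod.fst, invFun := fun v => (v, 0), left_inv := fun y => Prod.ext rfl (Subsingleton.elim _ _),
        right_inv := fun v => rfl, map_add' := fun _ _ => rfl }
    rw [Nat.card_congr e.mapAddSubgroup.toEquiv]
    simp
  | succ x ih =>
    have : Finite Z := Nat.finite_of_card_ne_zero (by rw [hZ]; positivity)
    obtain ⟨g, hg⟩ := IsAddCyclic.exists_generator (α := Z)
    have hord : addOrderOf g = 2 ^ (x + 1) := by
      rw [← hZ]; exact addOrderOf_eq_card_of_forall_mem_zmultiples hg
    have hdvd : ∀ k : ℤ, k • g = 0 ↔ (2 ^ (x + 1) : ℤ) ∣ k := by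
      intro k
      rw [← addOrderOf_dvd_iff_zsmul_eq_zero, hord]
      push_cast; rfl
    have hkill : ∀ k : ℤ, k • g = 0 → ∀ v : V, k • v = 0 := by
      intro k hk v
      obtain ⟨m, rfl⟩ := (dvd_pow_self (2 : ℤ) (Nat.succ_ne_zero x)).trans ((hdvd k).1 hk)
      rw [mul_comm, mul_smul, two_zsmul, hV, smul_zero]
    -- The maximal subgroup is 2Z, of order 2^x; passing from it to Z adds |V/W| subgroups for each
    -- W.
    have hgZ : g ∉ AddSubgroup.zmultiples (2 • g) := by
      intro h
      obtain ⟨k, hk⟩ := AddSubgroup.mem_zmultiples_iff.1 h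
      have h1 : (2 * k - 1) • g = 0 := by
        rw [sub_smul, mul_comm, mul_smul, one_smul, sub_eq_zero, two_zsmul, ← two_nsmul, hk]
      have h2 := (dvd_pow_self (2 : ℤ) (Nat.succ_ne_zero x)).trans ((hdvd _).1 h1)
      omega
    have hZ' : ∀ z, z ∉ AddSubgroup.zmultiples (2 • g) → g ∈ AddSubgroup.zmultiples z := by
      intro z hz
      obtain ⟨k, rfl⟩ := AddSubgroup.mem_zmultiples_iff.1 (hg z)
      have hk : ¬ (2 : ℤ) ∣ k := by
        rintro ⟨m, rfl⟩
        refine hz (AddSubgroup.mem_zmultiples_iff.2 ⟨m, ?_⟩)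
        rw [mul_comm, mul_smul, two_zsmul, two_nsmul]
      have hcop : IsCoprime k (2 ^ (x + 1)) := by
        refine IsCoprime.pow_right ?_
        exact ((Int.prime_two.coprime_iff_not_dvd).2 hk).symm
      obtain ⟨a, b, hab⟩ := hcop
      refine AddSubgroup.mem_zmultiples_iff.2 ⟨a, ?_⟩
      have h0 : ((2 : ℤ) ^ (x + 1)) • g = 0 := (hdvd _).2 dvd_rfl
      rw [← mul_smul]
      calc (a * k) • g = (a * k) • g + b • ((2 : ℤ) ^ (x + 1)) • g := by rw [h0, smul_zero, add_zero]
        _ = g := by rw [← mul_smul, ← add_smul, hab, one_smul]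
    have hcard : Nat.card (AddSubgroup.zmultiples (2 • g)) = 2 ^ x := by
      rw [Nat.card_zmultiples, addOrderOf_nsmul, hord, pow_succ, Nat.gcd_mul_left_left]
      simp
    have h1 := ih (AddSubgroup.zmultiples (2 • g)) hcard
    rw [← sumSubgroups_one] at h1 ⊢
    rw [sumSubgroups_prod g hg hkill _ hgZ hZ', h1, ← Finset.sum_add_distrib]
    refine Finset.sum_congr rfl fun W _ => ?_
    push_cast
    ring

/-- Gaussian binomial coefficients for `q = 2`. -/
def gauss2 (m k : ℕ) : ℚ := ∏ i ∈ Finset.Icc 1 k, ((2 : ℚ) ^ (m - (i - 1)) - 1) / ((2 : ℚ) ^ i - 1)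

end CountSubgroups

section CountSubgroups

lemma gauss2_succ (m k : ℕ) : gauss2 m (k + 1) =
    gauss2 m k * (((2 : ℚ) ^ (m - k) - 1) / ((2 : ℚ) ^ (k + 1) - 1)) := by
  rw [gauss2, Finset.prod_Icc_succ_top (by omega), gauss2, Nat.add_sub_cancel]

lemma gauss2_succ_succ (m k : ℕ) : gauss2 (m + 1) (k + 1) =
    gauss2 m k * (((2 : ℚ) ^ (m + 1) - 1) / ((2 : ℚ) ^ (k + 1) - 1)) := by
  induction k with
  | zero => simp [gauss2]
  | succ k ih =>
    rw [gauss2_succ, ih, gauss2_succ, Nat.add_sub_add_right]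
    ring

/-- The q-Pascal rule for q = 2: a subspace of dimension k + 1 lies in the hyperplane, or meets it
in dimension k and is one of 2^(m-k) graphs. -/
lemma gauss2_pascal {m k : ℕ} (hk : k ≤ m) :
    gauss2 (m + 1) (k + 1) = gauss2 m (k + 1) + 2 ^ (m - k) * gauss2 m k := by
  rw [gauss2_succ_succ, gauss2_succ]
  have h1 : (2 : ℚ) ^ (k + 1) - 1 ≠ 0 := by
    have : (1 : ℚ) < 2 ^ (k + 1) := one_lt_pow₀ (by norm_num) (by omega)
    linarith
  have h2 : (2 : ℚ) ^ (m + 1) = 2 ^ (m - k) * 2 ^ (k + 1) := by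
    rw [← pow_add]; congr 1; omega
  field_simp
  rw [h2]
  ring

lemma gauss2_self_succ (m : ℕ) : gauss2 m (m + 1) = 0 := by
  rw [gauss2_succ]; simp

lemma gauss2_zero_right (m : ℕ) : gauss2 m 0 = 1 := by simp [gauss2]

/-- Splitting off one factor ℤ/2 gives the same recursion as the Pascal rule. The weight f is
arbitrary because the induction hypothesis is also applied to the reweighted function d ↦ (2^m / d)
f(2d). -/
lemma sumSubgroups_zmod_two_pow (m : ℕ) (f : ℕ → ℚ) :
    sumSubgroups (Fin m → ZMod 2) f = ∑ k ∈ Finset.range (m + 1), gauss2 m k * f (2 ^ k) := by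
  induction m generalizing f with
  | zero =>
    have := Fintype.ofFinite (AddSubgroup (Fin 0 → ZMod 2))
    rw [sumSubgroups_eq, Fintype.sum_subsingleton _ (⊥ : AddSubgroup (Fin 0 → ZMod 2))]
    simp [gauss2]
  | succ m ih =>
    have := Fintype.ofFinite (AddSubgroup (Fin m → ZMod 2))
    let e : (Fin (m + 1) → ZMod 2) ≃+ (Fin m → ZMod 2) × ZMod 2 :=
      { toFun := fun v => (fun i => v i.succ, v 0)
        invFun := fun y => Fin.cons y.2 y.1
        left_inv := fun v => by
          ext i
          refine Fin.cases ?_ (fun j => ?_) i <;> simp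
        right_inv := fun y => by simp
        map_add' := fun _ _ => rfl }
    let e' : (Fin m → ZMod 2) × (⊥ : AddSubgroup (ZMod 2)) ≃+ (Fin m → ZMod 2) :=
      { toFun := Prod.fst, invFun := fun v => (v, 0)
        left_inv := fun y => Prod.ext rfl (Subsingleton.elim _ _)
        right_inv := fun v => rfl, map_add' := fun _ _ => rfl }
    have hgen : ∀ z : ZMod 2, z ∈ AddSubgroup.zmultiples (1 : ZMod 2) := fun z =>
      AddSubgroup.mem_zmultiples_iff.2 ⟨z.val, by simp⟩
    have hkill : ∀ k : ℤ, k • (1 : ZMod 2) = 0 → ∀ v : Fin m → ZMod 2, k • v = 0 := by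
      intro k hk v
      ext i
      have h1 : ((k : ZMod 2)) = 0 := by simpa using hk
      simp [h1]
    have hbot : ∀ z, z ∉ (⊥ : AddSubgroup (ZMod 2)) → (1 : ZMod 2) ∈ AddSubgroup.zmultiples z := by
      intro z hz
      have h1 : z = 1 := by
        revert hz; rw [AddSubgroup.mem_bot]; revert z; decide
      rw [h1]
      exact AddSubgroup.mem_zmultiples _
    rw [sumSubgroups_congr e, sumSubgroups_prod (1 : ZMod 2) hgen hkill ⊥ (by simp) hbot,
      sumSubgroups_congr e', ih]
    · obtain ⟨F, hF⟩ : ∃ F : ℕ → ℚ, F = fun d : ℕ => (2 : ℚ) ^ m / d * f (d * 2) := ⟨_, rfl⟩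
      have h1 : ∀ W : AddSubgroup (Fin m → ZMod 2),
          (Nat.card ((Fin m → ZMod 2) ⧸ W) : ℚ) * f (Nat.card W * Nat.card (ZMod 2)) =
            F (Nat.card W) := by
        intro W
        rw [hF]
        have h2 := AddSubgroup.card_eq_card_quotient_mul_card_addSubgroup W
        have h3 : Nat.card (Fin m → ZMod 2) = 2 ^ m := by simp
        rw [h3] at h2
        have h4 : (Nat.card W : ℚ) ≠ 0 := Nat.cast_ne_zero.2 Nat.card_pos.ne'
        have h5 : (2 : ℚ) ^ m = Nat.card ((Fin m → ZMod 2) ⧸ W) * Nat.card W := by exact_mod_cast h2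
        simp only [Nat.card_zmod]
        rw [h5, mul_div_cancel_right₀ _ h4]
      rw [Finset.sum_congr rfl fun W _ => h1 W, ← sumSubgroups_eq, ih, hF,
        Finset.sum_range_succ' _ (m + 1), gauss2_zero_right]
      have h6 : ∀ k ∈ Finset.range (m + 1), gauss2 (m + 1) (k + 1) * f (2 ^ (k + 1)) =
          gauss2 m (k + 1) * f (2 ^ (k + 1)) +
            gauss2 m k * ((2 : ℚ) ^ m / ((2 ^ k : ℕ) : ℚ) * f (2 ^ k * 2)) := by
        intro k hk
        rw [Finset.mem_range] at hk
        rw [gauss2_pascal (by omega), pow_succ, pow_sub₀ _ (by norm_num) (by omega)]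
        push_cast
        ring
      rw [Finset.sum_congr rfl h6, Finset.sum_add_distrib, add_right_comm]
      congr 1
      rw [Finset.sum_range_succ' _ m, gauss2_zero_right, Finset.sum_range_succ _ m, gauss2_self_succ,
        zero_mul, add_zero]

lemma card_addSubgroup_zmod_two_pow (m : ℕ) :
    (Nat.card (AddSubgroup (Fin m → ZMod 2)) : ℚ) = ∑ k ∈ Finset.range (m + 1), gauss2 m k := by
  rw [← sumSubgroups_one, sumSubgroups_zmod_two_pow]
  simp

/-- A subgroup W of order 2^k contributes x · 2^(m-k) + 1. The index m + 1 in `SigmaSum` counts the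
cyclic factor together with the m factors of order 2. -/
lemma card_addSubgroup_zmod_two_pow_prod (m x : ℕ) (Z : Type) [AddCommGroup Z] [IsAddCyclic Z]
    (hZ : Nat.card Z = 2 ^ x) :
    (Nat.card (AddSubgroup ((Fin m → ZMod 2) × Z)) : ℚ) = SigmaSum x (m + 1) := by
  have := Fintype.ofFinite (AddSubgroup (Fin m → ZMod 2))
  rw [card_addSubgroup_prod (fun v => ?_) x Z hZ]
  · obtain ⟨F, hF⟩ : ∃ F : ℕ → ℚ, F = fun d : ℕ => x * ((2 : ℚ) ^ m / d) + 1 := ⟨_, rfl⟩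
    have h1 : ∀ W : AddSubgroup (Fin m → ZMod 2),
        (x * (Nat.card ((Fin m → ZMod 2) ⧸ W) : ℚ) + 1) =
          F (Nat.card W) := by
      intro W
      rw [hF]
      have h2 := AddSubgroup.card_eq_card_quotient_mul_card_addSubgroup W
      have h3 : Nat.card (Fin m → ZMod 2) = 2 ^ m := by simp
      rw [h3] at h2
      have h4 : (Nat.card W : ℚ) ≠ 0 := Nat.cast_ne_zero.2 Nat.card_pos.ne'
      have h5 : (2 : ℚ) ^ m = Nat.card ((Fin m → ZMod 2) ⧸ W) * Nat.card W := by exact_mod_cast h2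
      simp only
      rw [h5, mul_div_cancel_right₀ _ h4]
    rw [Finset.sum_congr rfl fun W _ => h1 W, ← sumSubgroups_eq, sumSubgroups_zmod_two_pow, SigmaSum, hF]
    refine Finset.sum_congr rfl fun k hk => ?_
    rw [Finset.mem_range] at hk
    rw [mul_comm (gauss2 m k)]
    congr 1
    · rw [Nat.add_sub_add_right, pow_sub₀ _ (by norm_num) (by omega)]
      push_cast
      ring
    · refine Finset.prod_congr rfl fun i hi => ?_
      rw [Finset.mem_Icc] at hi
      rw [show m - (i - 1) = m + 1 - i by omega]
  · ext i
    exact CharTwo.add_self_eq_zero _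

/-! ### Cyclic groups and products of coprime order -/

/-- Subgroups of a finite cyclic group correspond to the divisors of its order. -/
def addSubgroupEquivDivisors (C : Type*) [AddCommGroup C] [Finite C] [IsAddCyclic C] :
    AddSubgroup C ≃ {d // d ∈ (Nat.card C).divisors} := by
  refine Equiv.ofBijective (fun A => ⟨Nat.card A, Nat.mem_divisors.2
    ⟨AddSubgroup.card_addSubgroup_dvd_card A, Nat.card_pos.ne'⟩⟩) ⟨fun A B h => ?_, ?_⟩
  · classical
    have := Fintype.ofFinite C
    have hcard : Nat.card A = Nat.card B := congrArg Subtype.val h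
    -- A subgroup of order d lies in the d-torsion, which has at most d elements in a cyclic group;
    -- so it is determined by its order.
    have key : ∀ A : AddSubgroup C, (Finset.univ.filter fun a : C => a ∈ A) =
        Finset.univ.filter fun a : C => Nat.card A • a = 0 := by
      intro A
      refine Finset.eq_of_subset_of_card_le (fun a ha => ?_) ?_
      · rw [Finset.mem_filter] at ha ⊢
        refine ⟨ha.1, ?_⟩
        have := card_nsmul_eq_zero' (x := (⟨a, ha.2⟩ : A))
        exact congrArg Subtype.val this
      · refine (IsAddCyclic.card_nsmul_eq_zero_le Nat.card_pos).trans (le_of_eq ?_)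
        rw [Nat.card_eq_fintype_card, Fintype.card_subtype]
    ext a
    have h1 := congrArg (fun s => a ∈ s) ((key A).trans ((hcard ▸ rfl : _ = _).trans (key B).symm))
    simpa using h1
  · rintro ⟨d, hd⟩
    obtain ⟨⟨m, hm⟩, h0⟩ := Nat.mem_divisors.1 hd
    obtain ⟨g, hg⟩ := IsAddCyclic.exists_generator (α := C)
    refine ⟨AddSubgroup.zmultiples (m • g), Subtype.ext ?_⟩
    have hmpos : 0 < m := Nat.pos_of_ne_zero (by rintro rfl; exact h0 (by simpa using hm))
    simp only
    rw [Nat.card_zmultiples, addOrderOf_nsmul, addOrderOf_eq_card_of_forall_mem_zmultiples hg, hm,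
      Nat.gcd_mul_left_left, Nat.mul_div_cancel _ hmpos]

lemma addSubgroup_eq_prod_of_coprime {P C : Type*} [AddCommGroup P] [AddCommGroup C] [Finite P]
    [Finite C] (h : (Nat.card P).Coprime (Nat.card C)) (A : AddSubgroup (P × C)) :
    A = (A.map (AddMonoidHom.fst P C)).prod (A.map (AddMonoidHom.snd P C)) := by
  have hdec : ∀ a ∈ A, (a.1, (0 : C)) ∈ A ∧ ((0 : P), a.2) ∈ A := by
    intro a ha
    have h1 : ((a.1, 0) : P × C) ∈ A := by
      -- Multiplication by this k is the projection onto P, and A is stable under it.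
      obtain ⟨k, hk1, hk0⟩ := Nat.chineseRemainder h 1 0
      have h2 : k • a = (a.1, 0) := by
        refine Prod.ext ?_ ?_
        · rw [Prod.smul_fst]
          have := (nsmul_eq_nsmul_iff_modEq (x := a.1) (n := k) (m := 1)).2
            (hk1.of_dvd (addOrderOf_dvd_natCard _))
          simpa using this
        · rw [Prod.smul_snd]
          have := (nsmul_eq_nsmul_iff_modEq (x := a.2) (n := k) (m := 0)).2
            (hk0.of_dvd (addOrderOf_dvd_natCard _))
          simpa using this
      rw [← h2]
      exact A.nsmul_mem ha k
    refine ⟨h1, ?_⟩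
    have h2 := A.sub_mem ha h1
    rwa [show a - (a.1, 0) = (0, a.2) from Prod.ext (sub_self _) (sub_zero _)] at h2
  ext ⟨x, y⟩
  rw [AddSubgroup.mem_prod]
  constructor
  · intro hxy
    exact ⟨⟨_, hxy, rfl⟩, ⟨_, hxy, rfl⟩⟩
  · rintro ⟨⟨a, ha, rfl⟩, ⟨b, hb, rfl⟩⟩
    simpa using A.add_mem (hdec a ha).1 (hdec b hb).2

/-- Subgroups of a product of groups of coprime order, one of them cyclic. -/
lemma card_addSubgroup_prod_of_coprime {P C : Type*} [AddCommGroup P] [AddCommGroup C] [Finite P]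
    [Finite C] [IsAddCyclic C] (h : (Nat.card P).Coprime (Nat.card C)) (T : Finset ℕ)
    (hT : ∀ t ∈ T, t.Coprime (Nat.card P)) :
    Nat.card {A : AddSubgroup (P × C) // ∀ t ∈ T, t ∣ Nat.card A} =
      Nat.card (AddSubgroup P) * ((Nat.card C).divisors.filter fun d => ∀ t ∈ T, t ∣ d).card := by
  have hprod : ∀ (B : AddSubgroup P) (E : AddSubgroup C), Nat.card (B.prod E) =
      Nat.card B * Nat.card E := fun B E => by
    rw [Nat.card_congr (AddSubgroup.prodEquiv B E).toEquiv, Nat.card_prod]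
  have hdvd : ∀ (B : AddSubgroup P) (E : AddSubgroup C), ∀ t ∈ T,
      t ∣ Nat.card (B.prod E) ↔ t ∣ Nat.card E := fun B E t ht => by
    rw [hprod]
    exact ((hT t ht).coprime_dvd_right (AddSubgroup.card_addSubgroup_dvd_card B)).dvd_mul_left
  let Φ : AddSubgroup P × {E : AddSubgroup C // ∀ t ∈ T, t ∣ Nat.card E} →
      {A : AddSubgroup (P × C) // ∀ t ∈ T, t ∣ Nat.card A} := fun y =>
    ⟨y.1.prod y.2.1, fun t ht => (hdvd _ _ t ht).2 (y.2.2 t ht)⟩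
  have hΦ : Function.Bijective Φ := by
    constructor
    · rintro ⟨B, E, hE⟩ ⟨B', E', hE'⟩ hBE
      have h1 : B.prod E = B'.prod E' := congrArg Subtype.val hBE
      have h2 : B = B' := by
        ext b
        have := congrArg (fun A => (b, (0 : C)) ∈ A) h1
        simpa [AddSubgroup.mem_prod, zero_mem] using this
      have h3 : E = E' := by
        ext b
        have := congrArg (fun A => ((0 : P), b) ∈ A) h1
        simpa [AddSubgroup.mem_prod, zero_mem] using this
      subst h2 h3
      rfl
    · rintro ⟨A, hA⟩
      have h1 := addSubgroup_eq_prod_of_coprime h A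
      refine ⟨⟨_, _, fun t ht => ?_⟩, Subtype.ext h1.symm⟩
      have := hA t ht
      rw [h1] at this
      exact (hdvd _ _ t ht).1 this
  rw [← Nat.card_congr (Equiv.ofBijective Φ hΦ), Nat.card_prod]
  congr 1
  have e : {E : AddSubgroup C // ∀ t ∈ T, t ∣ Nat.card E} ≃
      {d // d ∈ (Nat.card C).divisors.filter fun d => ∀ t ∈ T, t ∣ d} :=
    ((addSubgroupEquivDivisors C).subtypeEquiv
      (q := fun d => ∀ t ∈ T, t ∣ d.1) fun E => Iff.rfl).trans
      ((Equiv.subtypeSubtypeEquivSubtypeInter _ (fun d => ∀ t ∈ T, t ∣ d)).trans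
        (Equiv.subtypeEquivRight fun d => by rw [Finset.mem_filter]))
  rw [Nat.card_congr e, Nat.card_eq_fintype_card, Fintype.card_coe]

end CountSubgroups

/-! ### Arithmetic of Cunningham chains -/

namespace IsCunninghamChain

variable {l : ℕ} {p : ℕ → ℕ} (hp : IsCunninghamChain l p)
include hp

lemma lt_of_lt {i j : ℕ} (hi : 1 ≤ i) (hij : i < j) (hj : j ≤ l) : p j < p i := by
  induction j, hij using Nat.le_induction with
  | base =>
    have := hp.step i hi (by omega)
    have := (hp.prime (i + 1) (Finset.mem_Icc.2 ⟨by omega, hj⟩)).pos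
    change p (i + 1) < p i
    omega
  | succ j hij ih =>
    have h1 := hp.step j (by omega) (by omega)
    have h2 := ih (by omega)
    omega

lemma injOn {i j : ℕ} (hi : i ∈ Finset.Icc 1 l) (hj : j ∈ Finset.Icc 1 l) (h : p i = p j) :
    i = j := by
  rw [Finset.mem_Icc] at hi hj
  rcases lt_trichotomy i j with h1 | h1 | h1
  · have := hp.lt_of_lt hi.1 h1 hj.2; omega
  · exact h1
  · have := hp.lt_of_lt hj.1 h1 hi.2; omega

/-- For j < l the only odd prime factor of p_j - 1 = 2 p_{j+1} is p_{j+1}. No prime of the chain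
divides p_l - 1, since p_l is the smallest of them. -/
lemma eq_succ_of_dvd {i j : ℕ} (hi : i ∈ Finset.Icc 1 l) (hj : j ∈ Finset.Icc 1 l)
    (h : p i ∣ p j - 1) : i = j + 1 := by
  have hi' := Finset.mem_Icc.1 hi
  have hj' := Finset.mem_Icc.1 hj
  have hpi := hp.prime i hi
  have hpj := hp.prime j hj
  rcases Nat.lt_or_ge j l with hjl | hjl
  · have h1 := hp.step j hj'.1 hjl
    have hj1 : j + 1 ∈ Finset.Icc 1 l := Finset.mem_Icc.2 ⟨by omega, hjl⟩
    rw [h1, Nat.add_sub_cancel, hpi.dvd_mul] at h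
    rcases h with h | h
    · have h2 := (Nat.prime_dvd_prime_iff_eq hpi Nat.prime_two).1 h
      have h3 := hp.odd i hi
      rw [h2] at h3
      exact absurd h3 (by decide)
    · exact hp.injOn hi hj1 ((Nat.prime_dvd_prime_iff_eq hpi (hp.prime _ hj1)).1 h)
  · obtain rfl : j = l := by omega
    have h1 := Nat.le_of_dvd (by have := hpj.two_le; omega) h
    rcases hi'.2.lt_or_eq with h2 | h2
    · have := hp.lt_of_lt hi'.1 h2 le_rfl; omega
    · subst h2; have := hpi.two_le; omega

end IsCunninghamChain

/-- The unit group is cyclic of order 2r; reduction modulo r has kernel of order 2. -/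
lemma exists_hom_units_zmod (q r : ℕ) [Fact q.Prime] (h : q = 2 * r + 1) :
    ∃ φ : (ZMod q)ˣ →* Multiplicative (ZMod r), ∀ a, φ a = 1 → a ^ 2 = 1 := by
  have hcard : Nat.card (ZMod q)ˣ = 2 * r := by
    rw [Nat.card_eq_fintype_card, ZMod.card_units, h, Nat.add_sub_cancel]
  let e : Multiplicative (ZMod (Nat.card (ZMod q)ˣ)) ≃* (ZMod q)ˣ := zmodCyclicMulEquiv inferInstance
  have hdvd : r ∣ Nat.card (ZMod q)ˣ := hcard ▸ dvd_mul_left r 2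
  refine ⟨(AddMonoidHom.toMultiplicative (ZMod.castHom hdvd (ZMod r)).toAddMonoidHom).comp
    e.symm.toMonoidHom, fun a ha => ?_⟩
  have : NeZero (Nat.card (ZMod q)ˣ) := ⟨Nat.card_pos.ne'⟩
  apply e.symm.injective
  rw [map_pow, map_one]
  have h1 : ZMod.castHom hdvd (ZMod r) (e.symm a).toAdd = 0 := ha
  apply Multiplicative.toAdd.injective
  rw [toAdd_pow, toAdd_one]
  generalize (e.symm a).toAdd = y at h1
  rw [← ZMod.natCast_zmod_val y, map_natCast, ZMod.natCast_eq_zero_iff] at h1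
  rw [← ZMod.natCast_zmod_val y, nsmul_eq_mul, ← Nat.cast_mul, ZMod.natCast_eq_zero_iff]
  exact (dvd_of_eq hcard).trans (mul_dvd_mul_left 2 h1)

lemma exists_mulEquiv_units_zmod (p a b : ℕ) [Fact p.Prime] (hab : p - 1 = a * b)
    (hcop : a.Coprime b) : Nonempty (Multiplicative (ZMod a × ZMod b) ≃* (ZMod p)ˣ) := by
  have hcard : Nat.card (ZMod p)ˣ = a * b := by
    rw [Nat.card_eq_fintype_card, ZMod.card_units, hab]
  let e : Multiplicative (ZMod (Nat.card (ZMod p)ˣ)) ≃* (ZMod p)ˣ := zmodCyclicMulEquiv inferInstance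
  let f : ZMod (Nat.card (ZMod p)ˣ) ≃+ ZMod a × ZMod b :=
    ((ZMod.ringEquivCongr hcard).trans (ZMod.chineseRemainder hcop)).toAddEquiv
  exact ⟨(AddEquiv.toMultiplicative f.symm).trans e⟩

section Chain

variable {l : ℕ} {p : ℕ → ℕ}

/-- The exponent of the kernel of the projection of `(ℤ/n)ˣ` to its `p i`-part. -/
def chainExponent (l : ℕ) (p : ℕ → ℕ) (i : ℕ) : ℕ :=
  2 * ∏ j ∈ (Finset.Icc 1 l).filter fun j => j + 1 ≠ i, (p j - 1)

lemma IsCunninghamChain.not_dvd_chainExponent (hp : IsCunninghamChain l p) {i : ℕ}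
    (hi : i ∈ Finset.Icc 1 l) : ¬ p i ∣ chainExponent l p i := by
  have hpi := hp.prime i hi
  rw [chainExponent, hpi.dvd_mul, not_or]
  constructor
  · intro h
    have h2 := (Nat.prime_dvd_prime_iff_eq hpi Nat.prime_two).1 h
    have h3 := hp.odd i hi
    rw [h2] at h3
    exact absurd h3 (by decide)
  · rw [hpi.prime.dvd_finsetProd_iff]
    rintro ⟨j, hj, h⟩
    rw [Finset.mem_filter] at hj
    exact hj.2 (hp.eq_succ_of_dvd hi hj.1 h).symm

variable [hprime : ∀ i : {i // i ∈ Finset.Icc 1 l}, Fact (p i).Prime]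

/-- The p_i-part of the unit group sits in coordinate i - 1, so ψ projects there and kills only the
involution. The factor 2 of `chainExponent` deals with that coordinate, the factors p_j - 1 with the
others. -/
lemma IsCunninghamChain.exists_hom (hp : IsCunninghamChain l p)
    (i : {i // i ∈ Finset.Icc 1 l}) :
    ∃ ψ : (∀ i : {i // i ∈ Finset.Icc 1 l}, ZMod (p i))ˣ →* Multiplicative (ZMod (p i)),
      ∀ a, ψ a = 1 → a ^ chainExponent l p i = 1 := by
  have key : ∀ a : (∀ i : {i // i ∈ Finset.Icc 1 l}, ZMod (p i))ˣ,
      (∀ j : {i // i ∈ Finset.Icc 1 l}, (j : ℕ) + 1 = i →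
        (Units.map (Pi.evalMonoidHom _ j) a : (ZMod (p j))ˣ) ^ 2 = 1) →
      a ^ chainExponent l p i = 1 := by
    intro a ha
    apply MulEquiv.piUnits.injective
    rw [map_pow, map_one]
    ext1 j
    rw [Pi.pow_apply, Pi.one_apply]
    change (Units.map (Pi.evalMonoidHom _ j) a : (ZMod (p j))ˣ) ^ chainExponent l p i = 1
    by_cases hj : (j : ℕ) + 1 = i
    · rw [chainExponent, pow_mul, ha j hj, one_pow]
    · obtain ⟨k, hk⟩ : p j - 1 ∣ chainExponent l p i := Dvd.dvd.mul_left
        (Finset.dvd_prod_of_mem (fun j => p j - 1) (Finset.mem_filter.2 ⟨j.2, hj⟩)) _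
      rw [hk, pow_mul, ← ZMod.card_units (p j), pow_card_eq_one, one_pow]
  rcases Nat.lt_or_ge (i : ℕ) 2 with hi | hi
  -- For i = 1 there is no preceding coordinate, and the trivial homomorphism already has a kernel
  -- of exponent prime to p_1.
  · refine ⟨1, fun a _ => key a fun j hj => ?_⟩
    have := (Finset.mem_Icc.1 j.2).1
    omega
  · have hi' := Finset.mem_Icc.1 i.2
    have hj : (i : ℕ) - 1 ∈ Finset.Icc 1 l := Finset.mem_Icc.2 ⟨by omega, by omega⟩
    have h1 := hp.step ((i : ℕ) - 1) (by omega) (by omega)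
    rw [Nat.sub_add_cancel hi'.1] at h1
    have hfact : Fact (p ((i : ℕ) - 1)).Prime := hprime ⟨_, hj⟩
    obtain ⟨φ, hφ⟩ := exists_hom_units_zmod _ _ h1
    refine ⟨φ.comp (Units.map (Pi.evalMonoidHom (fun i : {i // i ∈ Finset.Icc 1 l} => ZMod (p i))
      ⟨_, hj⟩)), fun a ha => key a fun j hji => ?_⟩
    obtain rfl : j = ⟨(i : ℕ) - 1, hj⟩ := Subtype.ext (by simp only; omega)
    exact hφ _ ha

/-- An element of A of order p_i is nontrivial in some coordinate j ∉ I, where p_i must divide p_j -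
1; hence j = i - 1. -/
lemma IsCunninghamChain.exists_pred_of_isAffPair (hp : IsCunninghamChain l p)
    {I : Finset {i // i ∈ Finset.Icc 1 l}}
    {A : Subgroup (∀ i : {i // i ∈ Finset.Icc 1 l}, ZMod (p i))ˣ} (h : IsAffPair I A)
    {i : {i // i ∈ Finset.Icc 1 l}} (hi : i ∈ I) :
    ∃ j : {i // i ∈ Finset.Icc 1 l}, j ∉ I ∧ (j : ℕ) + 1 = i := by
  by_contra! hcon
  obtain ⟨a, ha⟩ := exists_prime_orderOf_dvd_card' (p i) (h i hi).2
  have h1 : (a : (∀ i : {i // i ∈ Finset.Icc 1 l}, ZMod (p i))ˣ) = 1 := by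
    apply MulEquiv.piUnits.injective
    rw [map_one]
    ext1 j
    by_cases hj : j ∈ I
    · exact Units.ext ((h j hj).1 a a.2)
    · have h2 : (MulEquiv.piUnits (a : (∀ i : {i // i ∈ Finset.Icc 1 l}, ZMod (p i))ˣ) j) ^ p i = 1 := by
        rw [← Pi.pow_apply, ← map_pow, ← Subgroup.coe_pow, ← ha, pow_orderOf_eq_one,
          Subgroup.coe_one, map_one, Pi.one_apply]
      have h3 := ZMod.units_pow_card_sub_one_eq_one (p j)
        (MulEquiv.piUnits (a : (∀ i : {i // i ∈ Finset.Icc 1 l}, ZMod (p i))ˣ) j)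
      have hcop : (p i).Coprime (p j - 1) := (Nat.Prime.coprime_iff_not_dvd (hprime i).out).2
        fun hd => hcon j hj (hp.eq_succ_of_dvd i.2 j.2 hd).symm
      have h4 := Nat.dvd_gcd (orderOf_dvd_of_pow_eq_one h2) (orderOf_dvd_of_pow_eq_one h3)
      rw [hcop, Nat.dvd_one, orderOf_eq_one_iff] at h4
      exact h4
  have h5 : a = 1 := Subtype.ext h1
  rw [h5, orderOf_one] at ha
  exact (hprime i).out.one_lt.ne ha

end Chain

/-! ### Counting the linear parts for a fixed set of missing coordinates -/

lemma card_subgroup_le_range {G H : Type*} [Group G] [Group H] (f : G →* H)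
    (hf : Function.Injective f) (T : Finset ℕ) :
    Nat.card {A : Subgroup H // A ≤ f.range ∧ ∀ t ∈ T, t ∣ Nat.card A} =
      Nat.card {B : Subgroup G // ∀ t ∈ T, t ∣ Nat.card B} := by
  have hcard (B : Subgroup G) : Nat.card (B.map f) = Nat.card B :=
    (Nat.card_congr (B.equivMapOfInjective f hf).toEquiv).symm
  refine Nat.card_congr (Equiv.symm
    { toFun B := ⟨B.1.map f, Subgroup.map_le_range f B.1, fun t ht => hcard B.1 ▸ B.2 t ht⟩
      invFun A := ⟨A.1.comap f, fun t ht => by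
        rw [← hcard, Subgroup.map_comap_eq_self A.2.1]; exact A.2.2 t ht⟩
      left_inv B := Subtype.ext (Subgroup.comap_map_eq_self_of_injective hf B.1)
      right_inv A := Subtype.ext (Subgroup.map_comap_eq_self A.2.1) })

section

variable {ι : Type} [Fintype ι] [DecidableEq ι] {p : ι → ℕ} [∀ i, Fact (p i).Prime]

/-- Units that are 1 on I form the product of the cyclic groups of order a_j b_j over j ∉ I.
Regrouping all a-parts and all b-parts lets the two be counted separately. -/
lemma card_isAffPair_eq (I : Finset ι) (a b : ι → ℕ) (hab : ∀ i, p i - 1 = a i * b i)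
    (hcop : ∀ i, (a i).Coprime (b i)) :
    Nat.card {A : Subgroup (∀ i, ZMod (p i))ˣ // IsAffPair I A} =
      Nat.card {B : AddSubgroup ((∀ j : {j // j ∉ I}, ZMod (a j)) × (∀ j : {j // j ∉ I}, ZMod (b j)))
        // ∀ t ∈ I.image p, t ∣ Nat.card B} := by
  let θ (i : ι) : Multiplicative (ZMod (a i) × ZMod (b i)) ≃* (ZMod (p i))ˣ :=
    (exists_mulEquiv_units_zmod (p i) (a i) (b i) (hab i) (hcop i)).some
  let pr (j : {j // j ∉ I}) :
      Multiplicative ((∀ j : {j // j ∉ I}, ZMod (a j)) × (∀ j : {j // j ∉ I}, ZMod (b j))) →*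
        Multiplicative (ZMod (a j) × ZMod (b j)) :=
    AddMonoidHom.toMultiplicative (AddMonoidHom.prodMap
      (Pi.evalAddMonoidHom (fun j : {j // j ∉ I} => ZMod (a j)) j)
      (Pi.evalAddMonoidHom (fun j : {j // j ∉ I} => ZMod (b j)) j))
  let g := MonoidHom.pi fun i : ι =>
    if h : i ∉ I then (θ i).toMonoidHom.comp (pr ⟨i, h⟩) else 1
  have hg (z) (i : ι) (h : i ∉ I) : g z i = θ i (pr ⟨i, h⟩ z) := by
    simp [g, MonoidHom.pi, h]
  have hg' (z) (i : ι) (h : i ∈ I) : g z i = 1 := by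
    simp [g, MonoidHom.pi, h]
  let f := (MulEquiv.piUnits (M := fun i => ZMod (p i))).symm.toMonoidHom.comp g
  have hf : Function.Injective f := by
    intro z w hfzw
    have hzw : g z = g w := (MulEquiv.piUnits (M := fun i => ZMod (p i))).symm.injective hfzw
    have key (j : {j // j ∉ I}) : pr j z = pr j w := by
      apply (θ j).injective
      rw [← hg z j j.2, ← hg w j j.2, hzw]
    apply Multiplicative.toAdd.injective
    exact Prod.ext (funext fun j => congrArg (fun t => t.toAdd.1) (key j))
      (funext fun j => congrArg (fun t => t.toAdd.2) (key j))
  have hrange (u : (∀ i, ZMod (p i))ˣ) : u ∈ f.range ↔ ∀ i ∈ I, (u : ∀ i, ZMod (p i)) i = 1 := by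
    constructor
    · rintro ⟨z, rfl⟩ i hi
      exact congrArg Units.val (hg' z i hi)
    · intro h
      refine ⟨Multiplicative.ofAdd (fun j => ((θ j).symm (MulEquiv.piUnits u j)).toAdd.1,
        fun j => ((θ j).symm (MulEquiv.piUnits u j)).toAdd.2), ?_⟩
      apply MulEquiv.piUnits.injective
      refine (MulEquiv.apply_symm_apply _ _).trans (funext fun i => ?_)
      by_cases hi : i ∈ I
      · rw [hg' _ i hi]
        exact Units.ext (h i hi).symm
      · rw [hg _ i hi]
        exact (θ i).apply_symm_apply _
  have h1 := card_subgroup_le_range f hf (I.image p)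
  have h2 (A : Subgroup (∀ i, ZMod (p i))ˣ) :
      IsAffPair I A ↔ A ≤ f.range ∧ ∀ t ∈ I.image p, t ∣ Nat.card A := by
    simp only [IsAffPair, SetLike.le_def, hrange, Finset.forall_mem_image]
    exact ⟨fun h => ⟨fun a ha i hi => (h i hi).1 a ha, fun i hi => (h i hi).2⟩,
      fun h i hi => ⟨fun a ha => h.1 ha i hi, h.2 hi⟩⟩
  rw [Nat.card_congr (Equiv.subtypeEquivRight h2), h1]
  refine Nat.card_congr (Equiv.subtypeEquiv AddSubgroup.toSubgroup.toEquiv.symm fun B => ?_)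
  exact Iff.rfl

end

lemma card_addSubgroup_congr {A B : Type*} [AddGroup A] [AddGroup B] (e : A ≃+ B) :
    Nat.card (AddSubgroup A) = Nat.card (AddSubgroup B) :=
  Nat.card_congr e.mapAddSubgroup.toEquiv

lemma card_addSubgroup_pi_zmod_two {κ : Type*} [Fintype κ] (e : κ → ℕ) (he : ∀ j, e j = 2) :
    (Nat.card (AddSubgroup (∀ j, ZMod (e j))) : ℚ) =
      ∑ k ∈ Finset.range (Fintype.card κ + 1), gauss2 (Fintype.card κ) k := by
  rw [← card_addSubgroup_zmod_two_pow, card_addSubgroup_congr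
    ((AddEquiv.piCongrRight fun j => (ZMod.ringEquivCongr (he j)).toAddEquiv).trans
      (LinearEquiv.funCongrLeft ℤ (ZMod 2) (Fintype.equivFin κ).symm).toAddEquiv)]

lemma card_addSubgroup_pi_zmod_two_insert {κ : Type} [Fintype κ] (e : κ → ℕ) (i : κ) {x : ℕ}
    (hi : e i = 2 ^ x) (he : ∀ j, j ≠ i → e j = 2) :
    (Nat.card (AddSubgroup (∀ j, ZMod (e j))) : ℚ) = SigmaSum x (Fintype.card κ) := by
  classical
  have hcard : Fintype.card κ = Fintype.card {j // j ≠ i} + 1 := by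
    rw [Fintype.card_subtype_compl, Fintype.card_subtype_eq,
      Nat.sub_add_cancel (Fintype.card_pos_iff.2 ⟨i⟩)]
  have hsplit : (∀ j, ZMod (e j)) ≃+ (∀ j : {j // j ≠ i}, ZMod (e j)) × ZMod (e i) :=
    { (Equiv.piSplitAt i fun j => ZMod (e j)).trans (Equiv.prodComm _ _) with
      map_add' := fun _ _ => rfl }
  rw [hcard, ← card_addSubgroup_zmod_two_pow_prod (Fintype.card {j // j ≠ i}) x (ZMod (e i))
    (by rw [Nat.card_zmod, hi]), card_addSubgroup_congr (hsplit.trans (AddEquiv.prodCongr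
    ((AddEquiv.piCongrRight fun j : {j // j ≠ i} =>
      (ZMod.ringEquivCongr (he j j.2)).toAddEquiv).trans
      (LinearEquiv.funCongrLeft ℤ (ZMod 2) (Fintype.equivFin {j // j ≠ i}).symm).toAddEquiv)
    (AddEquiv.refl (ZMod (e i)))))]

lemma isAddCyclic_pi_zmod {κ : Type*} [Fintype κ] (q : κ → ℕ)
    (hq : Pairwise fun i j => (q i).Coprime (q j)) : IsAddCyclic (∀ j, ZMod (q j)) :=
  isAddCyclic_of_surjective (ZMod.prodEquivPi q hq).toAddEquiv (RingEquiv.surjective _)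

/-- The `2`-part of `p j - 1` for a Cunningham chain. -/
def chainTwoPart (l x j : ℕ) : ℕ := if j = l then 2 ^ x else 2

/-- The odd part of `p j - 1` for a Cunningham chain. -/
def chainOddPart (l s : ℕ) (p : ℕ → ℕ) (j : ℕ) : ℕ := if j = l then s else p (j + 1)

namespace IsCunninghamChain

variable {l : ℕ} {p : ℕ → ℕ} (hp : IsCunninghamChain l p) {x s : ℕ}
  (hxs : p l - 1 = 2 ^ x * s) (hs : Odd s)
include hp

include hxs in
lemma sub_one_eq {j : ℕ} (hj : j ∈ Finset.Icc 1 l) :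
    p j - 1 = chainTwoPart l x j * chainOddPart l s p j := by
  rw [Finset.mem_Icc] at hj
  unfold chainTwoPart chainOddPart
  split_ifs with h
  · rw [h, hxs]
  · rw [hp.step j hj.1 (by omega), Nat.add_sub_cancel]

include hs in
lemma odd_chainOddPart {j : ℕ} (hj : j ∈ Finset.Icc 1 l) : Odd (chainOddPart l s p j) := by
  rw [Finset.mem_Icc] at hj
  unfold chainOddPart
  split_ifs with h
  · exact hs
  · exact hp.odd _ (Finset.mem_Icc.2 ⟨by omega, by omega⟩)

lemma prime_chainOddPart {j : ℕ} (hj : j ∈ Finset.Icc 1 l) (h : j ≠ l) :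
    (chainOddPart l s p j).Prime := by
  rw [Finset.mem_Icc] at hj
  rw [chainOddPart, if_neg h]
  exact hp.prime _ (Finset.mem_Icc.2 ⟨by omega, by omega⟩)

include hxs hs in
-- For j < l the odd parts are the distinct primes p_{j+1}, and s is smaller than p_l, hence not
-- divisible by any of them.
lemma coprime_chainOddPart {j k : ℕ} (hj : j ∈ Finset.Icc 1 l) (hk : k ∈ Finset.Icc 1 l)
    (hjk : j ≠ k) : (chainOddPart l s p j).Coprime (chainOddPart l s p k) := by
  wlog h : j < k generalizing j k
  · exact (this hk hj hjk.symm (by omega)).symm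
  have hj' := Finset.mem_Icc.1 hj
  have hk' := Finset.mem_Icc.1 hk
  have hjl : j ≠ l := by omega
  have hjm : j + 1 ∈ Finset.Icc 1 l := Finset.mem_Icc.2 ⟨by omega, by omega⟩
  have hpj := hp.prime_chainOddPart (s := s) hj hjl
  rw [hpj.coprime_iff_not_dvd]
  rw [chainOddPart, if_neg hjl] at hpj ⊢
  by_cases hkl : k = l
  · rw [chainOddPart, if_pos hkl]
    intro hd
    have h1 := Nat.le_of_dvd hs.pos hd
    have h2 : s ≤ p l - 1 := hxs ▸ Nat.le_mul_of_pos_left s (by positivity)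
    have h3 : p l ≤ p (j + 1) := by
      rcases (Finset.mem_Icc.1 hjm).2.lt_or_eq with h4 | h4
      · exact (hp.lt_of_lt (by omega) h4 le_rfl).le
      · rw [h4]
    have := hpj.two_le
    omega
  · have hkm : k + 1 ∈ Finset.Icc 1 l := Finset.mem_Icc.2 ⟨by omega, by omega⟩
    rw [chainOddPart, if_neg hkl, Nat.prime_dvd_prime_iff_eq hpj (hp.prime _ hkm)]
    intro h5
    have := hp.injOn hjm hkm h5
    omega

include hxs hs in
lemma card_divisors_prod_chainOddPart {U : Finset ℕ} (hU : U ⊆ Finset.Icc 1 l) (hl : l ∉ U) :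
    (∏ j ∈ U, chainOddPart l s p j).divisors.card = 2 ^ U.card := by
  rw [← ArithmeticFunction.sigma_zero_apply,
    ArithmeticFunction.isMultiplicative_sigma.map_prod _ _ fun j hj k hk hjk =>
      hp.coprime_chainOddPart hxs hs (hU hj) (hU hk) hjk]
  refine Finset.prod_eq_pow_card fun j hj => ?_
  have hq := hp.prime_chainOddPart (s := s) (hU hj) (ne_of_mem_of_not_mem hj hl)
  rw [ArithmeticFunction.sigma_zero_apply, hq.divisors, Finset.card_pair hq.one_lt.ne]

include hxs hs in
lemma card_divisors_prod_chainOddPart_of_mem {U : Finset ℕ} (hU : U ⊆ Finset.Icc 1 l)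
    (hl : l ∈ U) : (∏ j ∈ U, chainOddPart l s p j).divisors.card =
      2 ^ (U.card - 1) * ArithmeticFunction.sigma 0 s := by
  have hU' : U.erase l ⊆ Finset.Icc 1 l := (Finset.erase_subset _ _).trans hU
  have hq : chainOddPart l s p l = s := if_pos rfl
  rw [← Finset.prod_erase_mul U _ hl, Nat.Coprime.card_divisors_mul
    (Nat.Coprime.prod_left fun j hj => hp.coprime_chainOddPart hxs hs (hU' hj) (hU hl)
      (Finset.ne_of_mem_erase hj)), hp.card_divisors_prod_chainOddPart hxs hs hU'
    (Finset.notMem_erase _ _), Finset.card_erase_of_mem hl, hq,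
    ArithmeticFunction.sigma_zero_apply]

end IsCunninghamChain

/-- The indices outside `I` and not preceding an element of `I`. -/
def freeIndices (l : ℕ) (I : Finset ℕ) : Finset ℕ :=
  (Finset.Icc 1 l \ I) \ I.image (· - 1)

lemma freeIndices_subset (l : ℕ) (I : Finset ℕ) : freeIndices l I ⊆ Finset.Icc 1 l :=
  Finset.sdiff_subset.trans Finset.sdiff_subset

section

variable {l : ℕ} {I : Finset ℕ} (hI : I ∈ sparseSubsets l)
include hI

lemma mem_Icc_two_of_mem_sparseSubsets {i : ℕ} (hi : i ∈ I) : 2 ≤ i ∧ i ≤ l :=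
  Finset.mem_Icc.1 (Finset.mem_powerset.1 (Finset.mem_filter.1 hI).1 hi)

lemma injOn_pred_of_mem_sparseSubsets : Set.InjOn (· - 1) (I : Set ℕ) := by
  intro i hi j hj hij
  have h1 := mem_Icc_two_of_mem_sparseSubsets hI hi
  have h2 := mem_Icc_two_of_mem_sparseSubsets hI hj
  simp only at hij
  omega

lemma image_pred_subset_sdiff : I.image (· - 1) ⊆ Finset.Icc 1 l \ I := by
  rw [Finset.image_subset_iff]
  intro i hi
  have h1 := mem_Icc_two_of_mem_sparseSubsets hI hi
  rw [Finset.mem_sdiff, Finset.mem_Icc]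
  refine ⟨by omega, fun h => (Finset.mem_filter.1 hI).2 _ h ?_⟩
  rwa [Nat.sub_add_cancel (by omega)]

lemma card_sdiff_of_mem_sparseSubsets : (Finset.Icc 1 l \ I).card = l - I.card := by
  rw [Finset.card_sdiff_of_subset, Nat.card_Icc, Nat.add_sub_cancel]
  intro i hi
  have h1 := mem_Icc_two_of_mem_sparseSubsets hI hi
  exact Finset.mem_Icc.2 ⟨by omega, h1.2⟩

lemma card_freeIndices : (freeIndices l I).card = l - 2 * I.card := by
  rw [freeIndices, Finset.card_sdiff_of_subset (image_pred_subset_sdiff hI),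
    card_sdiff_of_mem_sparseSubsets hI,
    Finset.card_image_of_injOn (injOn_pred_of_mem_sparseSubsets hI)]
  omega

lemma mem_freeIndices_self (hl : 1 ≤ l) (h : l ∉ I) : l ∈ freeIndices l I := by
  rw [freeIndices, Finset.mem_sdiff, Finset.mem_sdiff, Finset.mem_Icc, Finset.mem_image]
  refine ⟨⟨⟨hl, le_rfl⟩, h⟩, ?_⟩
  rintro ⟨i, hi, h1⟩
  have h2 := mem_Icc_two_of_mem_sparseSubsets hI hi
  omega

/-- The coordinate i - 1 preceding an i in I has odd part p_i. These factors are forced to divide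
|A|, so only the free indices leave a choice. -/
lemma prod_sdiff_chainOddPart (p : ℕ → ℕ) (s : ℕ) :
    ∏ j ∈ Finset.Icc 1 l \ I, chainOddPart l s p j =
      (∏ i ∈ I, p i) * ∏ j ∈ freeIndices l I, chainOddPart l s p j := by
  rw [← Finset.prod_sdiff (image_pred_subset_sdiff hI), mul_comm,
    Finset.prod_image (injOn_pred_of_mem_sparseSubsets hI)]
  congr 1
  refine Finset.prod_congr rfl fun i hi => ?_
  have h1 := mem_Icc_two_of_mem_sparseSubsets hI hi
  rw [chainOddPart, if_neg (by omega), Nat.sub_add_cancel (by omega)]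

end

lemma card_filter_divisors_mul {a d : ℕ} (ha : a ≠ 0) (hd : d ≠ 0) (P : ℕ → Prop)
    [DecidablePred P] (hP : ∀ k, P k ↔ a ∣ k) :
    ((a * d).divisors.filter P).card = d.divisors.card := by
  rw [← Finset.card_map ⟨(a * ·), mul_right_injective₀ ha⟩ (s := d.divisors)]
  congr 1
  ext k
  simp only [Finset.mem_filter, Nat.mem_divisors, hP, Finset.mem_map, Function.Embedding.coeFn_mk]
  constructor
  · rintro ⟨⟨h1, -⟩, k, rfl⟩
    exact ⟨k, ⟨Nat.dvd_of_mul_dvd_mul_left (Nat.pos_of_ne_zero ha) h1, hd⟩, rfl⟩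
  · rintro ⟨k, ⟨h1, -⟩, rfl⟩
    exact ⟨⟨mul_dvd_mul_left a h1, mul_ne_zero ha hd⟩, dvd_mul_right a k⟩

/-- The part of `{1, …, l}` outside `I`, as a subset and as a subtype of a subtype. -/
def sdiffEquivSubtype (l : ℕ) (I : Finset ℕ) :
    {j : {i // i ∈ Finset.Icc 1 l} // j ∉ I.subtype (· ∈ Finset.Icc 1 l)} ≃
      {j // j ∈ Finset.Icc 1 l \ I} where
  toFun j := ⟨(j : {i // i ∈ Finset.Icc 1 l}), by
    have h := j.2
    rw [Finset.mem_subtype] at h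
    exact Finset.mem_sdiff.2 ⟨j.1.2, h⟩⟩
  invFun j := ⟨⟨j, (Finset.mem_sdiff.1 j.2).1⟩, by
    rw [Finset.mem_subtype]
    exact (Finset.mem_sdiff.1 j.2).2⟩
  left_inv _ := rfl
  right_inv _ := rfl

section

variable {l : ℕ} {p : ℕ → ℕ} [hprime : ∀ i : {i // i ∈ Finset.Icc 1 l}, Fact (p i).Prime]

/-- The odd part of the ambient group is cyclic, and divisors of its order divisible by all p_i with
i in I correspond to divisors of the cofactor. The conditions do not touch the 2-part. -/
lemma IsCunninghamChain.card_isAffPair_eq_mul (hp : IsCunninghamChain l p) {x s : ℕ}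
    (hxs : p l - 1 = 2 ^ x * s) (hs : Odd s) {I : Finset ℕ} (hI : I ∈ sparseSubsets l) :
    Nat.card {A : Subgroup (∀ i : {i // i ∈ Finset.Icc 1 l}, ZMod (p i))ˣ //
        IsAffPair (I.subtype (· ∈ Finset.Icc 1 l)) A} =
      Nat.card (AddSubgroup (∀ j : {j // j ∈ Finset.Icc 1 l \ I}, ZMod (chainTwoPart l x j))) *
        (∏ j ∈ freeIndices l I, chainOddPart l s p j).divisors.card := by
  have hIsub : I ⊆ Finset.Icc 1 l := fun i hi => by
    have := mem_Icc_two_of_mem_sparseSubsets hI hi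
    exact Finset.mem_Icc.2 ⟨by omega, this.2⟩
  let κ := {j : {i // i ∈ Finset.Icc 1 l} // j ∉ I.subtype (· ∈ Finset.Icc 1 l)}
  have htwo (j : ℕ) : ∃ k, chainTwoPart l x j = 2 ^ k := by
    unfold chainTwoPart
    split_ifs
    exacts [⟨x, rfl⟩, ⟨1, rfl⟩]
  have hodd {j : ℕ} (hj : j ∈ Finset.Icc 1 l) := hp.odd_chainOddPart hs hj
  have hcop {i j : ℕ} (hj : Odd j) : (chainTwoPart l x i).Coprime j := by
    obtain ⟨k, hk⟩ := htwo i
    rw [hk]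
    exact Nat.Coprime.pow_left k (Nat.coprime_two_left.2 hj)
  have : ∀ j : κ, NeZero (chainTwoPart l x j) := fun j => by
    obtain ⟨k, hk⟩ := htwo j
    exact ⟨hk ▸ by positivity⟩
  have : ∀ j : κ, NeZero (chainOddPart l s p j) := fun j => ⟨(hodd j.1.2).pos.ne'⟩
  have : IsAddCyclic (∀ j : κ, ZMod (chainOddPart l s p j)) :=
    isAddCyclic_pi_zmod _ fun i j hij => hp.coprime_chainOddPart hxs hs i.1.2 j.1.2
      fun h => hij (Subtype.ext (Subtype.ext h))
  have hP : Nat.card (∀ j : κ, ZMod (chainTwoPart l x j)) = ∏ j : κ, chainTwoPart l x j := by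
    rw [Nat.card_pi]
    exact Finset.prod_congr rfl fun j _ => Nat.card_zmod _
  have hC : Nat.card (∀ j : κ, ZMod (chainOddPart l s p j)) =
      (∏ i ∈ I, p i) * ∏ j ∈ freeIndices l I, chainOddPart l s p j := by
    rw [Nat.card_pi, ← prod_sdiff_chainOddPart hI,
      ← Finset.prod_coe_sort (Finset.Icc 1 l \ I) (chainOddPart l s p)]
    exact Fintype.prod_equiv (sdiffEquivSubtype l I) _ _ fun j => Nat.card_zmod _
  rw [card_isAffPair_eq (p := fun i : {i // i ∈ Finset.Icc 1 l} => p i) _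
    (fun i => chainTwoPart l x i) (fun i => chainOddPart l s p i)
    (fun i => hp.sub_one_eq hxs i.2) (fun i => hcop (hodd i.2))]
  rw [card_addSubgroup_prod_of_coprime]
  · congr 1
    · exact card_addSubgroup_congr (LinearEquiv.piCongrLeft' ℤ
        (fun j : κ => ZMod (chainTwoPart l x j)) (sdiffEquivSubtype l I)).toAddEquiv
    · rw [hC]
      refine card_filter_divisors_mul
        (Finset.prod_ne_zero_iff.2 fun i hi => (hp.prime i (hIsub hi)).ne_zero)
        (Finset.prod_ne_zero_iff.2 fun j hj => (hodd
          (Finset.mem_sdiff.1 (Finset.mem_sdiff.1 hj).1).1).pos.ne') _ fun k => ?_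
      constructor
      · intro h
        refine Finset.prod_dvd_of_isRelPrime (fun i hi j hj hij => ?_) fun i hi => h _ ?_
        · rw [Function.onFun, ← Nat.coprime_iff_isRelPrime]
          exact (Nat.coprime_primes (hp.prime i (hIsub hi)) (hp.prime j (hIsub hj))).2
            fun h => hij (hp.injOn (hIsub hi) (hIsub hj) h)
        · exact Finset.mem_image.2 ⟨⟨i, hIsub hi⟩, Finset.mem_subtype.2 hi, rfl⟩
      · intro h t ht
        obtain ⟨i, hi, rfl⟩ := Finset.mem_image.1 ht
        exact (Finset.dvd_prod_of_mem p (Finset.mem_subtype.1 hi)).trans h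
  · rw [hP, Nat.card_pi]
    refine Nat.Coprime.prod_left fun i _ => Nat.Coprime.prod_right fun j _ => ?_
    rw [Nat.card_zmod]
    exact hcop (hodd j.1.2)
  · intro t ht
    obtain ⟨i, hi, rfl⟩ := Finset.mem_image.1 ht
    rw [hP]
    exact Nat.Coprime.prod_right fun j _ => (hcop (hp.odd i i.2)).symm

lemma IsCunninghamChain.card_isAffPair_of_mem (hp : IsCunninghamChain l p) {x s : ℕ}
    (hxs : p l - 1 = 2 ^ x * s) (hs : Odd s) {I : Finset ℕ} (hI : I ∈ sparseSubsets l)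
    (hl : l ∈ I) :
    (Nat.card {A : Subgroup (∀ i : {i // i ∈ Finset.Icc 1 l}, ZMod (p i))ˣ //
        IsAffPair (I.subtype (· ∈ Finset.Icc 1 l)) A} : ℚ) =
      2 ^ (l - 2 * I.card) * ∑ k ∈ Finset.range (l - I.card + 1), gauss2 (l - I.card) k := by
  have htwo (j : {j // j ∈ Finset.Icc 1 l \ I}) : chainTwoPart l x j = 2 :=
    if_neg (ne_of_mem_of_not_mem hl (Finset.mem_sdiff.1 j.2).2).symm
  rw [hp.card_isAffPair_eq_mul hxs hs hI, hp.card_divisors_prod_chainOddPart hxs hs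
    (freeIndices_subset l I) (fun h => (Finset.mem_sdiff.1 (Finset.mem_sdiff.1 h).1).2 hl),
    Nat.cast_mul, card_addSubgroup_pi_zmod_two _ htwo, Fintype.card_coe,
    card_sdiff_of_mem_sparseSubsets hI, card_freeIndices hI, mul_comm, Nat.cast_pow,
    Nat.cast_ofNat]

lemma IsCunninghamChain.card_isAffPair_of_notMem (hp : IsCunninghamChain l p) (hl1 : 1 ≤ l)
    {x s : ℕ} (hxs : p l - 1 = 2 ^ x * s) (hs : Odd s) {I : Finset ℕ}
    (hI : I ∈ sparseSubsets l) (hl : l ∉ I) :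
    (Nat.card {A : Subgroup (∀ i : {i // i ∈ Finset.Icc 1 l}, ZMod (p i))ˣ //
        IsAffPair (I.subtype (· ∈ Finset.Icc 1 l)) A} : ℚ) =
      2 ^ (l - 1 - 2 * I.card) * SigmaSum x (l - I.card) *
        (ArithmeticFunction.sigma 0 s : ℚ) := by
  have hexp : l - 2 * I.card - 1 = l - 1 - 2 * I.card := by omega
  rw [hp.card_isAffPair_eq_mul hxs hs hI, hp.card_divisors_prod_chainOddPart_of_mem hxs hs
    (freeIndices_subset l I) (mem_freeIndices_self hI hl1 hl),
    card_freeIndices hI, Nat.cast_mul,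
    card_addSubgroup_pi_zmod_two_insert (fun j : {j // j ∈ Finset.Icc 1 l \ I} => chainTwoPart l x j)
      ⟨l, Finset.mem_sdiff.2 ⟨Finset.mem_Icc.2 ⟨hl1, le_rfl⟩, hl⟩⟩ (if_pos rfl)
      (fun j hj => if_neg fun h => hj (Subtype.ext h)),
    Fintype.card_coe, card_sdiff_of_mem_sparseSubsets hI, hexp]
  push_cast
  ring

lemma IsCunninghamChain.mem_sparseSubsets (hp : IsCunninghamChain l p) {I : Finset ℕ}
    (hI : I ⊆ Finset.Icc 1 l) {A : Subgroup (∀ i : {i // i ∈ Finset.Icc 1 l}, ZMod (p i))ˣ}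
    (h : IsAffPair (I.subtype (· ∈ Finset.Icc 1 l)) A) : I ∈ sparseSubsets l := by
  have key {i : ℕ} (hi : i ∈ I) : 2 ≤ i ∧ i ≤ l ∧ i - 1 ∉ I := by
    obtain ⟨j, hj, hji⟩ := hp.exists_pred_of_isAffPair h (i := ⟨i, hI hi⟩)
      (Finset.mem_subtype.2 hi)
    have h1 := Finset.mem_Icc.1 j.2
    have h2 := Finset.mem_Icc.1 (hI hi)
    simp only at hji
    refine ⟨by omega, h2.2, fun h3 => hj (Finset.mem_subtype.2 ?_)⟩
    rwa [show (j : ℕ) = i - 1 by omega]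
  rw [sparseSubsets, Finset.mem_filter, Finset.mem_powerset]
  refine ⟨fun i hi => Finset.mem_Icc.2 ⟨(key hi).1, (key hi).2.1⟩, fun i hi hi' => ?_⟩
  exact (key hi').2.2 hi

lemma IsCunninghamChain.card_isAffPair_eq_sum (hp : IsCunninghamChain l p) :
    Nat.card {y : Finset {i // i ∈ Finset.Icc 1 l} ×
        Subgroup (∀ i : {i // i ∈ Finset.Icc 1 l}, ZMod (p i))ˣ // IsAffPair y.1 y.2} =
      ∑ I ∈ sparseSubsets l,
        Nat.card {A : Subgroup (∀ i : {i // i ∈ Finset.Icc 1 l}, ZMod (p i))ˣ //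
          IsAffPair (I.subtype (· ∈ Finset.Icc 1 l)) A} := by
  have hsub : sparseSubsets l ⊆ (Finset.Icc 1 l).powerset := fun I hI =>
    Finset.mem_powerset.2 fun i hi => by
      have := mem_Icc_two_of_mem_sparseSubsets hI hi
      exact Finset.mem_Icc.2 ⟨by omega, this.2⟩
  rw [Nat.card_congr (Equiv.subtypeProdEquivSigmaSubtype fun I A => IsAffPair I A),
    Nat.card_sigma]
  -- A subset of {1, …, l} that contains 1 or two consecutive integers admits no A at all.
  rw [Finset.sum_subset hsub fun I hI hI' => by
    have : IsEmpty {A : Subgroup (∀ i : {i // i ∈ Finset.Icc 1 l}, ZMod (p i))ˣ //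
        IsAffPair (I.subtype (· ∈ Finset.Icc 1 l)) A} :=
      ⟨fun A => hI' (hp.mem_sparseSubsets (Finset.mem_powerset.1 hI) A.2)⟩
    exact Nat.card_of_isEmpty]
  symm
  refine Finset.sum_bij' (fun I _ => I.subtype (· ∈ Finset.Icc 1 l))
    (fun I _ => I.map (Function.Embedding.subtype _)) (fun _ _ => Finset.mem_univ _)
    (fun I _ => Finset.mem_powerset.2 fun i hi => ?_) (fun I hI => ?_) (fun I _ => ?_)
    (fun _ _ => rfl)
  · obtain ⟨j, -, rfl⟩ := Finset.mem_map.1 hi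
    exact j.2
  · exact Finset.subtype_map_of_mem fun i hi => Finset.mem_powerset.1 hI hi
  · ext i
    simp

end

theorem mainTheorem1 (l : ℕ) (hl : 1 ≤ l) (p : ℕ → ℕ) (hp : IsCunninghamChain l p)
    (n : ℕ) (hn : n = ∏ i ∈ Finset.Icc 1 l, p i)
    (x s : ℕ) (hxs : p l - 1 = 2 ^ x * s) (hs : Odd s) :
    (numRealisedTypes.{u} n (Multiplicative (ZMod n)) : ℚ) =
      ∑ I ∈ sparseSubsets l with l ∈ I, (2 : ℚ) ^ (l - 2 * I.card) *
        (∑ k ∈ Finset.range (l - I.card + 1), ∏ i ∈ Finset.Icc 1 k,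
          ((2 : ℚ) ^ (l - I.card - (i - 1)) - 1) / ((2 : ℚ) ^ i - 1)) +
      ∑ I ∈ sparseSubsets l with l ∉ I, (2 : ℚ) ^ (l - 1 - 2 * I.card) *
        SigmaSum x (l - I.card) * (ArithmeticFunction.sigma 0 s : ℚ) := by
  have hprime : ∀ i : {i // i ∈ Finset.Icc 1 l}, Fact (p i).Prime := fun i => ⟨hp.prime i i.2⟩
  choose ψ hψ using hp.exists_hom
  rw [numRealisedTypes_eq_card (p := fun i : {i // i ∈ Finset.Icc 1 l} => p i) ψ
    (fun i j h => Subtype.ext (hp.injOn i.2 j.2 h)) (fun i => hp.not_dvd_chainExponent i.2) hψ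
    (hn.trans (Finset.prod_coe_sort _ _).symm), hp.card_isAffPair_eq_sum, Nat.cast_sum,
    ← Finset.sum_filter_add_sum_filter_not _ (fun I => l ∈ I)]
  congr 1
  · refine Finset.sum_congr rfl fun I hI => ?_
    rw [Finset.mem_filter] at hI
    exact hp.card_isAffPair_of_mem hxs hs hI.1 hI.2
  · refine Finset.sum_congr rfl fun I hI => ?_
    rw [Finset.mem_filter] at hI
    exact hp.card_isAffPair_of_notMem hl hxs hs hI.1 hI.2

end
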